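/- Let $u,v:[0,1]\to[0,\infty)$ be continuous functions, each of which vanishes at some point of $[0,1]$. Let $k_1,k_2:[0,1]^2\to\mathbb{C}$ be continuous with $k_j(x,s)=\overline{k_j(s,x)}$, and assume that the integral operators $(K_j\varphi)(x)=\int_0^1 k_j(x,s)\varphi(s)\,ds$ on the complex Hilbert space $L_2[0,1]$ satisfy $K_1\ge 0$ and $K_2\ge 0$. Let $H_1=U_1-K_1$ and $H_2=U_2-K_2$ on $L_2[0,1]$, where $(U_1\varphi)(x)=u(x)\varphi(x)$ and $(U_2\varphi)(x)=v(x)\varphi(x)$. Let $T$ be the bounded self-adjoint "three-particle" operator on $L_2([0,1]^2)$ $$(Tf)(x,y)=(u(x)+v(y))f(x,y)-\int_0^1 k_1(x,s)f(s,y)\,ds-\int_0^1 k_2(y,t)f(x,t)\,dt .$$ For a bounded self-adjoint operator $A$, the discrete spectrum $\sigma_d(A)$ is the set of isolated points of $\sigma(A)$ that are eigenvalues of finite multiplicity, and the essential spectrum is $\sigma_e(A)=\sigma(A)\setminus\sigma_d(A)$. Assume that $v\not\equiv 0$ or $\sigma_d(H_1)$ is finite, and that $u\not\equiv 0$ or $\sigma_d(H_2)$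 is finite. Then $\sigma_e(T)$ is the union of finitely many (and at least one) closed bounded intervals $[a_i,b_i]\subset\mathbb{R}$ with $a_i\le b_i$. If $u\not\equiv 0$ and $v\not\equiv 0$, the intervals can be chosen so that $a_i<b_i$ for all $i$. -/

import Mathlib

noncomputable section

namespace FriedrichsModel

open MeasureTheory Complex
open scoped unitInterval ENNReal

set_option linter.unusedSectionVars false

/-! ### The discrete and the essential spectrum of a bounded self-adjoint operator -/

section Spectrum

variable {E : Type*} [NormedAddCommGroup E] [InnerProductSpace ℂ E]

/-- The discrete spectrum of a bounded (self-adjoint) operator: the isolated points of the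
spectrum that are eigenvalues of finite multiplicity. -/
def discreteSpectrum (A : E →L[ℂ] E) : Set ℂ :=
  {z | (∃ ε > 0, Metric.ball z ε ∩ spectrum ℂ A = {z}) ∧
    Module.End.HasEigenvalue (A : E →ₗ[ℂ] E) z ∧
    FiniteDimensional ℂ (Module.End.eigenspace (A : E →ₗ[ℂ] E) z)}

/-- The essential spectrum of a bounded (self-adjoint) operator: the part of the spectrum that
is not discrete. -/
def essentialSpectrum (A : E →L[ℂ] E) : Set ℂ :=
  spectrum ℂ A \ discreteSpectrum A

end Spectrum

/-! ### Multiplication operators and integral operators on `L²` -/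

/-- The complex Hilbert space `L²(X)`; for `X = [0,1]` and `X = [0,1]²` the measure is Lebesgue
measure. -/
abbrev L2 (X : Type*) [MeasureSpace X] : Type _ := Lp ℂ 2 (volume : Measure X)

section Operators

variable {X : Type*} [TopologicalSpace X] [CompactSpace X] [SecondCountableTopology X]
  [MeasureSpace X] [BorelSpace X]

theorem memLp_mul (w : C(X, ℝ)) (f : L2 X) :
    MemLp (fun x => (w x : ℂ) * f x) 2 (volume : Measure X) := by
  refine (Lp.memLp f).of_le_mul (c := ‖w‖)
    ((continuous_ofReal.comp w.continuous).aestronglyMeasurable.mul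
      (Lp.aestronglyMeasurable f)) (.of_forall fun x => ?_)
  rw [norm_mul, norm_real]
  exact mul_le_mul_of_nonneg_right (w.norm_coe_le_norm x) (norm_nonneg _)

/-- The operator of multiplication by the continuous function `w`, `(mulOp w f)(x) = w(x) f(x)`. -/
def mulOp (w : C(X, ℝ)) : L2 X →L[ℂ] L2 X :=
  LinearMap.mkContinuous
    { toFun := fun f => (memLp_mul w f).toLp
      map_add' := fun f g => by
        rw [← MemLp.toLp_add]
        refine MemLp.toLp_congr _ _ ?_
        filter_upwards [Lp.coeFn_add f g] with x hx
        simp only [hx, Pi.add_apply]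
        ring
      map_smul' := fun c f => by
        rw [RingHom.id_apply, ← MemLp.toLp_const_smul]
        refine MemLp.toLp_congr _ _ ?_
        filter_upwards [Lp.coeFn_smul c f] with x hx
        simp only [hx, Pi.smul_apply, smul_eq_mul]
        ring }
    ‖w‖ (fun f => by
      refine Lp.norm_le_mul_norm_of_ae_le_mul ?_
      filter_upwards [(memLp_mul w f).coeFn_toLp] with x hx
      simp only [LinearMap.coe_mk, AddHom.coe_mk, hx, norm_mul, norm_real]
      exact mul_le_mul_of_nonneg_right (w.norm_coe_le_norm x) (norm_nonneg _))

theorem mulOp_apply (w : C(X, ℝ)) (f : L2 X) :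
    mulOp w f =ᵐ[volume] fun x => (w x : ℂ) * f x :=
  (memLp_mul w f).coeFn_toLp

variable [IsProbabilityMeasure (volume : Measure X)]
  {Y : Type*} [MeasureSpace Y]

theorem memLp_kernel_mul (κ : C(X × I, ℂ)) {τ : X × I → Y}
    (hτ : MeasurePreserving τ) (f : L2 Y) :
    MemLp (fun p => κ p * f (τ p)) 2 (volume : Measure (X × I)) := by
  have h : MemLp (fun p => f (τ p)) 2 (volume : Measure (X × I)) :=
    (Lp.memLp f).comp_measurePreserving hτ
  refine h.of_le_mul (c := ‖κ‖) (κ.continuous.aestronglyMeasurable.mul h.1)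
    (.of_forall fun p => ?_)
  rw [norm_mul]
  exact mul_le_mul_of_nonneg_right (κ.norm_coe_le_norm p) (norm_nonneg _)

theorem eLpNorm_fiber_integral_le {F : X × I → ℂ}
    (hF : AEStronglyMeasurable F (volume : Measure (X × I))) :
    eLpNorm (fun x => ∫ s, F (x, s)) 2 (volume : Measure X) ≤ eLpNorm F 2 volume := by
  have hF' : AEStronglyMeasurable F ((volume : Measure X).prod (volume : Measure I)) := hF
  have key : (eLpNorm (fun x => ∫ s, F (x, s)) 2 (volume : Measure X)) ^ (2 : ℝ)
      ≤ (eLpNorm F 2 volume) ^ (2 : ℝ) := by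
    have e1 := eLpNorm_nnreal_pow_eq_lintegral (μ := (volume : Measure X))
      (f := fun x => ∫ s, F (x, s)) (p := 2) two_ne_zero
    have e2 := eLpNorm_nnreal_pow_eq_lintegral (μ := (volume : Measure (X × I)))
      (f := F) (p := 2) two_ne_zero
    simp only [NNReal.coe_ofNat, ENNReal.coe_ofNat] at e1 e2
    rw [e1, e2, Measure.volume_eq_prod, lintegral_prod _ (hF'.enorm.pow_const _)]
    refine lintegral_mono_ae ?_
    filter_upwards [hF'.prodMk_left] with x hx
    have e3 := eLpNorm_nnreal_pow_eq_lintegral (μ := (volume : Measure I))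
      (f := fun s => F (x, s)) (p := 2) two_ne_zero
    simp only [NNReal.coe_ofNat, ENNReal.coe_ofNat] at e3
    rw [← e3]
    refine ENNReal.rpow_le_rpow ?_ (by norm_num)
    calc ‖∫ s, F (x, s)‖ₑ ≤ ∫⁻ s, ‖F (x, s)‖ₑ := enorm_integral_le_lintegral_enorm _
      _ = eLpNorm (fun s => F (x, s)) 1 volume := eLpNorm_one_eq_lintegral_enorm.symm
      _ ≤ _ := eLpNorm_le_eLpNorm_of_exponent_le one_le_two hx
  exact (ENNReal.rpow_le_rpow_iff (by norm_num)).1 key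

theorem memLp_integralOp (κ : C(X × I, ℂ)) {τ : X × I → Y}
    (hτ : MeasurePreserving τ) (f : L2 Y) :
    MemLp (fun x => ∫ s, κ (x, s) * f (τ (x, s))) 2 (volume : Measure X) := by
  have h := memLp_kernel_mul κ hτ f
  exact ⟨AEStronglyMeasurable.integral_prod_right' (μ := (volume : Measure X))
    (ν := (volume : Measure I)) h.1, (eLpNorm_fiber_integral_le h.1).trans_lt h.2⟩

theorem integrable_fiber (κ : C(X × I, ℂ)) {τ : X × I → Y}
    (hτ : MeasurePreserving τ) (f : L2 Y) :
    ∀ᵐ x : X, Integrable (fun s : I => κ (x, s) * f (τ (x, s))) :=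
  Integrable.prod_right_ae (μ := (volume : Measure X)) (ν := (volume : Measure I))
    ((memLp_kernel_mul κ hτ f).integrable one_le_two)

theorem norm_integralOp_le (κ : C(X × I, ℂ)) {τ : X × I → Y}
    (hτ : MeasurePreserving τ) (f : L2 Y) :
    ‖(memLp_integralOp κ hτ f).toLp‖ ≤ ‖κ‖ * ‖f‖ := by
  have h := memLp_kernel_mul κ hτ f
  have h1 : eLpNorm (fun p => κ p * f (τ p)) 2 (volume : Measure (X × I))
      ≤ ENNReal.ofReal ‖κ‖ * eLpNorm (fun p => f (τ p)) 2 volume := by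
    refine eLpNorm_le_mul_eLpNorm_of_ae_le_mul (.of_forall fun p => ?_) 2
    rw [norm_mul]
    exact mul_le_mul_of_nonneg_right (κ.norm_coe_le_norm p) (norm_nonneg _)
  have h2 : eLpNorm (fun p => f (τ p)) 2 (volume : Measure (X × I)) = eLpNorm f 2 volume :=
    eLpNorm_comp_measurePreserving (Lp.aestronglyMeasurable f) hτ
  rw [h2] at h1
  have h3 := (eLpNorm_fiber_integral_le h.1).trans h1
  rw [Lp.norm_toLp, Lp.norm_def]
  refine (ENNReal.toReal_mono
    (ENNReal.mul_ne_top ENNReal.ofReal_ne_top (Lp.eLpNorm_ne_top f)) h3).trans_eq ?_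
  rw [ENNReal.toReal_mul, ENNReal.toReal_ofReal (norm_nonneg _)]

/-- The operator `(integralOp κ hτ f)(x) = ∫₀¹ κ(x, s) f(τ(x, s)) ds`. -/
def integralOp (κ : C(X × I, ℂ)) {τ : X × I → Y} (hτ : MeasurePreserving τ) :
    L2 Y →L[ℂ] L2 X :=
  LinearMap.mkContinuous
    { toFun := fun f => (memLp_integralOp κ hτ f).toLp
      map_add' := fun f g => by
        rw [← MemLp.toLp_add]
        refine MemLp.toLp_congr _ _ ?_
        have h : ∀ᵐ p : X × I, (f + g : L2 Y) (τ p) = f (τ p) + g (τ p) :=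
          hτ.quasiMeasurePreserving.ae (Lp.coeFn_add f g)
        filter_upwards [Measure.ae_ae_of_ae_prod h, integrable_fiber κ hτ f,
          integrable_fiber κ hτ g] with x hx hf hg
        rw [Pi.add_apply, ← integral_add hf hg]
        refine integral_congr_ae ?_
        filter_upwards [hx] with s hs
        rw [hs, mul_add]
      map_smul' := fun c f => by
        rw [RingHom.id_apply, ← MemLp.toLp_const_smul]
        refine MemLp.toLp_congr _ _ ?_
        have h : ∀ᵐ p : X × I, (c • f : L2 Y) (τ p) = c * f (τ p) :=
          hτ.quasiMeasurePreserving.ae (Lp.coeFn_smul c f)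
        filter_upwards [Measure.ae_ae_of_ae_prod h] with x hx
        rw [Pi.smul_apply, smul_eq_mul, ← integral_const_mul]
        refine integral_congr_ae ?_
        filter_upwards [hx] with s hs
        rw [hs]
        ring }
    ‖κ‖ (norm_integralOp_le κ hτ)

theorem integralOp_apply (κ : C(X × I, ℂ)) {τ : X × I → Y} (hτ : MeasurePreserving τ)
    (f : L2 Y) :
    integralOp κ hτ f =ᵐ[volume] fun x => ∫ s, κ (x, s) * f (τ (x, s)) :=
  (memLp_integralOp κ hτ f).coeFn_toLp

end Operators

/-! ### The Friedrichs model on `L²[0,1]` -/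

theorem measurePreserving_snd' : MeasurePreserving (fun p : I × I => p.2) :=
  measurePreserving_snd (μ := (volume : Measure I)) (ν := (volume : Measure I))

/-- `(K φ)(x) = ∫₀¹ k(x, s) φ(s) ds` on `L²[0,1]`. -/
def K (k : C(I × I, ℂ)) : L2 I →L[ℂ] L2 I :=
  integralOp k measurePreserving_snd'

theorem K_apply (k : C(I × I, ℂ)) (φ : L2 I) :
    K k φ =ᵐ[volume] fun x => ∫ s, k (x, s) * φ s :=
  integralOp_apply k measurePreserving_snd' φ

/-- The operator `H = U - K` of the Friedrichs model, `(U φ)(x) = u(x) φ(x)`. -/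
def H (u : C(I, ℝ)) (k : C(I × I, ℂ)) : L2 I →L[ℂ] L2 I :=
  mulOp u - K k

/-! ### The "three-particle" operator on `L²([0,1]²)` -/

theorem measurePreserving_replace_fst :
    MeasurePreserving (fun q : (I × I) × I => (q.2, q.1.2)) := by
  have h : MeasurePreserving (Prod.map Prod.snd id : (I × I) × I → I × I) :=
    measurePreserving_snd'.prod (MeasurePreserving.id _)
  exact Measure.measurePreserving_swap.comp h

theorem measurePreserving_replace_snd :
    MeasurePreserving (fun q : (I × I) × I => (q.1.1, q.2)) := by
  have h : MeasurePreserving (fun p : I × I => p.1) :=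
    measurePreserving_fst (μ := (volume : Measure I)) (ν := (volume : Measure I))
  exact h.prod (MeasurePreserving.id _)

/-- `(T₁ f)(x, y) = ∫₀¹ k(x, s) f(s, y) ds`. -/
def T₁ (k : C(I × I, ℂ)) : L2 (I × I) →L[ℂ] L2 (I × I) :=
  integralOp (⟨fun q => k (q.1.1, q.2), by fun_prop⟩ : C((I × I) × I, ℂ))
    measurePreserving_replace_fst

/-- `(T₂ f)(x, y) = ∫₀¹ k(y, t) f(x, t) dt`. -/
def T₂ (k : C(I × I, ℂ)) : L2 (I × I) →L[ℂ] L2 (I × I) :=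
  integralOp (⟨fun q => k (q.1.2, q.2), by fun_prop⟩ : C((I × I) × I, ℂ))
    measurePreserving_replace_snd

/-- `(T₀ f)(x, y) = (u(x) + v(y)) f(x, y)`. -/
def T₀ (u v : C(I, ℝ)) : L2 (I × I) →L[ℂ] L2 (I × I) :=
  mulOp ⟨fun p => u p.1 + v p.2, by fun_prop⟩

/-- The "three-particle" discrete Schrödinger operator `T = T₀ - (T₁ + T₂)`. -/
def T (u v : C(I, ℝ)) (k₁ k₂ : C(I × I, ℂ)) : L2 (I × I) →L[ℂ] L2 (I × I) :=
  T₀ u v - (T₁ k₁ + T₂ k₂)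

theorem T_apply (u v : C(I, ℝ)) (k₁ k₂ : C(I × I, ℂ)) (f : L2 (I × I)) :
    T u v k₁ k₂ f =ᵐ[volume] fun p =>
      ((u p.1 + v p.2 : ℝ) : ℂ) * f p
        - ((∫ s, k₁ (p.1, s) * f (s, p.2)) + ∫ t, k₂ (p.2, t) * f (p.1, t)) := by
  have e : T u v k₁ k₂ f = T₀ u v f - (T₁ k₁ f + T₂ k₂ f) := rfl
  rw [e]
  filter_upwards [Lp.coeFn_sub (T₀ u v f) (T₁ k₁ f + T₂ k₂ f),
    Lp.coeFn_add (T₁ k₁ f) (T₂ k₂ f), mulOp_apply _ f,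
    integralOp_apply _ measurePreserving_replace_fst f,
    integralOp_apply _ measurePreserving_replace_snd f] with p h1 h2 h3 h4 h5
  rw [h1, Pi.sub_apply, h2, Pi.add_apply]
  exact congrArg₂ _ h3 (congrArg₂ _ h4 h5)

end FriedrichsModel

end

/-! On L²([0,1]²) = L²[0,1] ⊗ L²[0,1] the operator T is H₁ ⊗ 1 + 1 ⊗ H₂, and the theorem follows
from σ_e(T) = ([0,‖u‖] + σ(H₂)) ∪ ([0,‖v‖] + σ(H₁)), which is `essentialSpectrum_T`.

Since u is continuous and has a zero, its range is [0,‖u‖]; K₁ is compact, so this range lies in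
σ_e(H₁). Compactness also makes the negative spectrum of H₁ discrete, with 0 as its only possible
limit point, and K₁ ≥ 0 rules out spectrum above ‖u‖. The same holds for H₂ and v.

For ⊇, an infinite-dimensional space on which H₁ - s is small, tensored with an approximate
eigenvector of H₂ at t, makes T - (s + t) small (`hasSingularSubspaces_add`). For ⊆, let W₁, W₂ be
finite-dimensional invariant subspaces carrying the spectrum of H₁, H₂ below a small -d. If z avoids
the right-hand side, T - z is bounded below on the complement of W₁ ⊗ W₂, so z is at most a discrete
eigenvalue (`IsHilbertTensor.mem_discreteSpectrum`).

Finally, in [0,M] + σ(H) all points of σ(H) above -M merge into one interval, and each of the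
finitely many points below -M adds one more (`exists_finset_Icc_add`). -/

noncomputable section

namespace FriedrichsModel

open MeasureTheory Complex
open scoped unitInterval ENNReal

/-! ### Bounded self-adjoint operators -/

section SelfAdjoint

set_option linter.unusedSectionVars false

variable {E : Type*} [NormedAddCommGroup E] [InnerProductSpace ℂ E] [CompleteSpace E]

theorem inner_self_eq_ofReal_norm_sq (f : E) : inner ℂ f f = ((‖f‖ ^ 2 : ℝ) : ℂ) := by
  rw [inner_self_eq_norm_sq_to_K, Complex.ofReal_pow]
  rfl

/-- The lower bound gives injectivity and closed range; by self-adjointness the complement of the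
range is the kernel, which is zero. -/
theorem isUnit_of_boundedBelow {D : E →L[ℂ] E} (hD : IsSelfAdjoint D) {c : ℝ} (hc : 0 < c)
    (h : ∀ f, c * ‖f‖ ≤ ‖D f‖) : IsUnit D := by
  have hanti : AntilipschitzWith (Real.toNNReal c⁻¹) D := by
    refine D.antilipschitz_of_bound fun x => ?_
    rw [Real.coe_toNNReal _ (inv_pos.2 hc).le, inv_mul_eq_div, le_div_iff₀ hc, mul_comm]
    exact h x
  rw [ContinuousLinearMap.isUnit_iff_bijective]
  refine ⟨hanti.injective, ?_⟩
  have hcl : IsClosed (D.range : Set E) := hanti.isClosed_range D.uniformContinuous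
  have := hcl.completeSpace_coe
  have htop : D.range = ⊤ := by
    rw [← D.range.orthogonal_orthogonal, Submodule.eq_top_iff']
    intro v w hw
    have h0 : D w = 0 := by
      rw [← inner_self_eq_zero (𝕜 := ℂ)]
      have := hw (D (D w)) ⟨_, rfl⟩
      exact (hD.isSymmetric (D w) w).symm.trans this
    rw [hanti.injective (h0.trans (map_zero D).symm), inner_zero_left]
  exact LinearMap.range_eq_top.1 htop

theorem isSelfAdjoint_sub_smul {S : E →L[ℂ] E} (hS : IsSelfAdjoint S) (w : ℝ) :
    IsSelfAdjoint (S - algebraMap ℂ (E →L[ℂ] E) (w : ℂ)) := by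
  refine hS.sub ?_
  rw [IsSelfAdjoint, ← algebraMap_star_comm]
  simp

theorem notMem_spectrum_of_boundedBelow {S : E →L[ℂ] E} (hS : IsSelfAdjoint S) {w : ℝ} {c : ℝ}
    (hc : 0 < c) (h : ∀ f, c * ‖f‖ ≤ ‖S f - (w : ℂ) • f‖) : (w : ℂ) ∉ spectrum ℂ S := by
  rw [spectrum.notMem_iff, ← IsUnit.neg_iff, neg_sub]
  exact isUnit_of_boundedBelow (isSelfAdjoint_sub_smul hS w) hc fun f => by
    simpa [Algebra.algebraMap_eq_smul_one] using h f

theorem exists_approx_of_mem_spectrum {S : E →L[ℂ] E} (hS : IsSelfAdjoint S) {w : ℝ}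
    (hw : (w : ℂ) ∈ spectrum ℂ S) {ε : ℝ} (hε : 0 < ε) :
    ∃ f, f ≠ 0 ∧ ‖S f - (w : ℂ) • f‖ ≤ ε * ‖f‖ := by
  by_contra! hcon
  refine notMem_spectrum_of_boundedBelow hS hε (fun f => ?_) hw
  rcases eq_or_ne f 0 with rfl | hf
  · simp
  · exact (hcon f hf).le

theorem exists_real_of_mem_spectrum {S : E →L[ℂ] E} (hS : IsSelfAdjoint S) {w : ℂ}
    (hw : w ∈ spectrum ℂ S) : ∃ r : ℝ, (r : ℂ) = w :=
  ⟨w.re, (hS.mem_spectrum_eq_re hw).symm⟩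

/-- The functional calculus of (t - w)⁻¹ inverts S - w and has norm at most d⁻¹. -/
theorem le_norm_apply_sub_of_le_dist {S : E →L[ℂ] E} (hS : IsSelfAdjoint S) {w : ℂ} {d : ℝ}
    (hd : 0 < d) (h : ∀ t ∈ spectrum ℂ S, d ≤ ‖t - w‖) (f : E) :
    d * ‖f‖ ≤ ‖S f - w • f‖ := by
  have hN : IsStarNormal S := hS.isStarNormal
  have hne : ∀ t ∈ spectrum ℂ S, t - w ≠ 0 := fun t ht => norm_pos_iff.1 (hd.trans_le (h t ht))
  have hcont : ContinuousOn (fun t : ℂ => (t - w)⁻¹) (spectrum ℂ S) :=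
    ContinuousOn.inv₀ (by fun_prop) hne
  have hmul : cfc (fun t : ℂ => (t - w)⁻¹) S * (S - algebraMap ℂ _ w) = 1 := by
    have e : S - algebraMap ℂ (E →L[ℂ] E) w = cfc (fun t : ℂ => t - w) S := by
      rw [cfc_sub (fun t : ℂ => t) (fun _ => w) S, cfc_id' ℂ S, cfc_const w S]
    rw [e, ← cfc_mul _ _ _ hcont, ← cfc_one ℂ S]
    exact cfc_congr fun t ht => inv_mul_cancel₀ (hne t ht)
  have hnorm : ‖cfc (fun t : ℂ => (t - w)⁻¹) S‖ ≤ d⁻¹ :=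
    norm_cfc_le (inv_pos.2 hd).le fun t ht => by
      rw [norm_inv]
      exact inv_anti₀ hd (h t ht)
  have hf := congrArg (fun R : E →L[ℂ] E => R f) hmul
  have hf' : cfc (fun t : ℂ => (t - w)⁻¹) S (S f - w • f) = f := by
    simpa [Algebra.algebraMap_eq_smul_one] using hf
  have : ‖f‖ ≤ d⁻¹ * ‖S f - w • f‖ := by
    conv_lhs => rw [← hf']
    exact (ContinuousLinearMap.le_opNorm _ _).trans
      (mul_le_mul_of_nonneg_right hnorm (norm_nonneg _))
  rwa [inv_mul_eq_div, le_div_iff₀ hd, mul_comm] at this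

/-- As z is isolated, the indicator p of {z} and g(t) = (t - z)⁻¹ are both continuous on the
spectrum. The identity p + g · (t - z) = 1 then says that g(S) inverts S - z modulo p(S), whose
range lies in the eigenspace. -/
theorem boundedBelow_orthogonal_of_isolated {S : E →L[ℂ] E} (hS : IsSelfAdjoint S) {z : ℂ} {ε : ℝ}
    (hε : 0 < ε) (h : Metric.ball z ε ∩ spectrum ℂ S = {z}) :
    ∃ c > 0, ∀ f ∈ (Module.End.eigenspace (S : E →ₗ[ℂ] E) z)ᗮ, c * ‖f‖ ≤ ‖S f - z • f‖ := by
  classical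
  have hN : IsStarNormal S := hS.isStarNormal
  have hiso : ∀ t ∈ spectrum ℂ S, t ∈ Metric.ball z ε → t = z := fun t ht hb => by
    have : t ∈ Metric.ball z ε ∩ spectrum ℂ S := ⟨hb, ht⟩
    rwa [h] at this
  have hcts : ∀ g : ℂ → ℂ, ContinuousOn g {z}ᶜ → ContinuousOn g (spectrum ℂ S) := by
    intro g hg t ht
    by_cases hz : t = z
    · refine ContinuousWithinAt.congr_of_eventuallyEq (f := fun _ => g z)
        continuousWithinAt_const ?_ (by rw [hz])
      filter_upwards [self_mem_nhdsWithin, mem_nhdsWithin_of_mem_nhds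
        (Metric.isOpen_ball.mem_nhds (hz ▸ Metric.mem_ball_self hε : t ∈ Metric.ball z ε))]
        with s hs hb
      rw [hiso s hs hb]
    · exact (hg.continuousAt (isOpen_compl_singleton.mem_nhds hz)).continuousWithinAt
  set p : ℂ → ℂ := fun t => if t = z then 1 else 0
  set g : ℂ → ℂ := fun t => (t - z)⁻¹
  have hp : ContinuousOn p (spectrum ℂ S) := hcts p <|
    (continuousOn_const (c := (0 : ℂ))).congr fun t ht => if_neg ht
  have hg : ContinuousOn g (spectrum ℂ S) := hcts g <|
    ContinuousOn.inv₀ (by fun_prop) fun t ht => sub_ne_zero.2 ht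
  have e : S - algebraMap ℂ (E →L[ℂ] E) z = cfc (fun t : ℂ => t - z) S := by
    rw [cfc_sub (fun t : ℂ => t) (fun _ => z) S, cfc_id' ℂ S, cfc_const z S]
  have h1 : (S - algebraMap ℂ (E →L[ℂ] E) z) * cfc p S = 0 := by
    rw [e, ← cfc_mul _ _ _ (by fun_prop) hp, ← cfc_zero ℂ S]
    refine cfc_congr fun t _ => ?_
    by_cases ht : t = z <;> simp [p, ht]
  have h2 : cfc p S + cfc g S * (S - algebraMap ℂ (E →L[ℂ] E) z) = 1 := by
    rw [e, ← cfc_mul _ _ _ hg, ← cfc_add S p (fun t => g t * (t - z)) hp (hg.mul (by fun_prop)), ← cfc_one ℂ S]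
    refine cfc_congr fun t _ => ?_
    by_cases ht : t = z
    · simp [p, ht]
    · simp [p, g, ht, sub_ne_zero.2 ht]
  refine ⟨(‖cfc g S‖ + 1)⁻¹, by positivity, fun f hf => ?_⟩
  have k1 : S (cfc p S f) - z • cfc p S f = 0 := by
    simpa [Algebra.algebraMap_eq_smul_one] using congrArg (fun R : E →L[ℂ] E => R f) h1
  have k2 : cfc p S f + cfc g S (S f - z • f) = f := by
    simpa [Algebra.algebraMap_eq_smul_one] using congrArg (fun R : E →L[ℂ] E => R f) h2
  have k3 : inner ℂ (cfc p S f) f = 0 :=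
    hf _ (Module.End.mem_eigenspace_iff.2 (sub_eq_zero.1 k1))
  have k4 : ‖f‖ ^ 2 ≤ ‖cfc g S (S f - z • f)‖ * ‖f‖ := by
    rw [← inner_self_eq_norm_sq (𝕜 := ℂ)]
    conv_lhs => rw [← k2]
    nth_rw 2 [k2]
    rw [inner_add_left, k3, zero_add]
    exact re_inner_le_norm _ _
  have k5 : ‖f‖ ≤ (‖cfc g S‖ + 1) * ‖S f - z • f‖ := by
    have hle : ‖f‖ ≤ ‖cfc g S (S f - z • f)‖ := by
      rcases (norm_nonneg f).eq_or_lt with h0 | h0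
      · rw [← h0]; positivity
      · exact le_of_mul_le_mul_right (by linarith [sq ‖f‖]) h0
    refine hle.trans ((ContinuousLinearMap.le_opNorm _ _).trans ?_)
    exact mul_le_mul_of_nonneg_right (by linarith) (norm_nonneg _)
  rw [inv_mul_eq_div, div_le_iff₀ (by positivity), mul_comm]
  exact k5

/-- `S - z` is arbitrarily small on infinite-dimensional subspaces. -/
def HasSingularSubspaces (S : E →L[ℂ] E) (z : ℂ) : Prop :=
  ∀ ε > 0, ∃ V : Submodule ℂ E, ¬ FiniteDimensional ℂ V ∧ ∀ f ∈ V, ‖S f - z • f‖ ≤ ε * ‖f‖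

/-- Otherwise the orthogonal projection to N would embed V in a finite-dimensional space. -/
theorem exists_mem_orthogonal_of_not_finiteDimensional {V N : Submodule ℂ E}
    (hV : ¬ FiniteDimensional ℂ V) [FiniteDimensional ℂ N] : ∃ f ∈ V, f ∈ Nᗮ ∧ f ≠ 0 := by
  by_contra! hcon
  refine hV (FiniteDimensional.of_injective
    ((N.orthogonalProjectionOnto : E →ₗ[ℂ] N).comp V.subtype) ?_)
  rw [← LinearMap.ker_eq_bot, LinearMap.ker_eq_bot']
  intro f hf
  exact Subtype.ext (hcon f f.2 (Submodule.orthogonalProjectionOnto_eq_zero_iff.1 hf))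

/-- Singular subspaces exclude a lower bound for S - z on the complement of any finite-dimensional
N. Such a bound would hold with N = 0 if z were outside the spectrum, and with N the eigenspace if z
were discrete. -/
theorem HasSingularSubspaces.mem_essentialSpectrum {S : E →L[ℂ] E} (hS : IsSelfAdjoint S) {z : ℝ}
    (h : HasSingularSubspaces S z) : (z : ℂ) ∈ essentialSpectrum S := by
  have key : ∀ (N : Submodule ℂ E) [FiniteDimensional ℂ N], ∀ c > 0,
      ¬ ∀ f ∈ Nᗮ, c * ‖f‖ ≤ ‖S f - (z : ℂ) • f‖ := by
    intro N _ c hc hN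
    obtain ⟨V, hV, hVS⟩ := h (c / 2) (by positivity)
    obtain ⟨f, hf, hfN, h0⟩ := exists_mem_orthogonal_of_not_finiteDimensional (N := N) hV
    have := (hN f hfN).trans (hVS f hf)
    have := norm_pos_iff.2 h0
    nlinarith
  constructor
  · by_contra hz
    have hne : ∃ d > 0, ∀ t ∈ spectrum ℂ S, d ≤ ‖t - z‖ := by
      obtain ⟨d, hd, hb⟩ := Metric.isOpen_iff.1 (spectrum.isClosed S).isOpen_compl _ hz
      refine ⟨d, hd, fun t ht => ?_⟩
      by_contra! hlt
      exact hb (by simpa [dist_eq_norm] using hlt) ht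
    obtain ⟨d, hd, hdist⟩ := hne
    exact key ⊥ d hd fun f _ => le_norm_apply_sub_of_le_dist hS hd hdist f
  · rintro ⟨⟨ε, hε, hiso⟩, -, hfin⟩
    obtain ⟨c, hc, hb⟩ := boundedBelow_orthogonal_of_isolated hS hε hiso
    exact key _ c hc hb

theorem mem_orthogonal_of_invariant {S : E →L[ℂ] E} (hS : IsSelfAdjoint S) {W : Submodule ℂ E}
    (hW : ∀ f ∈ W, S f ∈ W) : ∀ f ∈ Wᗮ, S f ∈ Wᗮ := by
  intro f hf g hg
  rw [← ContinuousLinearMap.coe_coe, ← hS.isSymmetric]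
  exact hf _ (hW g hg)

theorem norm_sq_add_of_mem_orthogonal {W : Submodule ℂ E} {a b : E} (ha : a ∈ W) (hb : b ∈ Wᗮ) :
    ‖a + b‖ ^ 2 = ‖a‖ ^ 2 + ‖b‖ ^ 2 := by
  have := norm_add_sq_eq_norm_sq_add_norm_sq_of_inner_eq_zero a b (hb a ha)
  simpa [sq] using this

/-! ### Lower bounds off a finite-dimensional invariant subspace -/

section Gap

variable {S : E →L[ℂ] E} {W : Submodule ℂ E} [FiniteDimensional ℂ W]

/-- S splits along W ⊕ Wᗮ, and the block on Wᗮ has no spectrum in the ball, so there only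
eigenvalues of the matrix block on W remain. -/
theorem finite_spectrum_inter_ball (hS : IsSelfAdjoint S) (hW : ∀ f ∈ W, S f ∈ W) {z ε : ℝ}
    (h : ∀ f ∈ Wᗮ, ε * ‖f‖ ≤ ‖S f - (z : ℂ) • f‖) :
    (Metric.ball (z : ℂ) ε ∩ spectrum ℂ S).Finite ∧
      ∀ w ∈ Metric.ball (z : ℂ) ε ∩ spectrum ℂ S,
        Module.End.HasEigenvalue (S : E →ₗ[ℂ] E) w := by
  set R : Module.End ℂ W := (S : E →ₗ[ℂ] E).restrict hW
  have key : ∀ w ∈ Metric.ball (z : ℂ) ε ∩ spectrum ℂ S, R.HasEigenvalue w := by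
    rintro w ⟨hwz, hw⟩
    obtain ⟨r, rfl⟩ := exists_real_of_mem_spectrum hS hw
    by_contra hev
    have hinj : LinearMap.ker (R - algebraMap ℂ (Module.End ℂ W) r) = ⊥ := by
      rw [Algebra.algebraMap_eq_smul_one, ← Module.End.eigenspace_def]
      simpa [Module.End.hasEigenvalue_iff] using hev
    obtain ⟨C, hC, hanti⟩ := LinearMap.exists_antilipschitzWith _ hinj
    have hlow : ∀ f ∈ W, (C : ℝ)⁻¹ * ‖f‖ ≤ ‖S f - (r : ℂ) • f‖ := by
      intro f hf
      have := hanti.le_mul_dist ⟨f, hf⟩ 0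
      rw [map_zero, dist_zero_right, dist_zero_right] at this
      rw [inv_mul_eq_div, div_le_iff₀ (by exact_mod_cast hC), mul_comm]
      simpa [R, Algebra.algebraMap_eq_smul_one] using this
    have hε' : 0 < ε - ‖(r : ℂ) - z‖ := by
      rw [Metric.mem_ball, dist_eq_norm] at hwz
      linarith
    -- On W the bound comes from injectivity in finite dimension; on Wᗮ it is what is left of ε
    -- after moving from z to r.
    set c := min (C : ℝ)⁻¹ (ε - ‖(r : ℂ) - z‖)
    have hc : 0 < c := lt_min (by positivity) hε'
    refine notMem_spectrum_of_boundedBelow hS hc (fun f => ?_) hw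
    obtain ⟨a, ha, b, hb, rfl⟩ := W.exists_add_mem_mem_orthogonal f
    have hA : c * ‖a‖ ≤ ‖S a - (r : ℂ) • a‖ :=
      (mul_le_mul_of_nonneg_right (min_le_left _ _) (norm_nonneg _)).trans (hlow a ha)
    have hB : c * ‖b‖ ≤ ‖S b - (r : ℂ) • b‖ := by
      refine (mul_le_mul_of_nonneg_right (min_le_right _ _) (norm_nonneg _)).trans ?_
      have h1 : S b - (z : ℂ) • b = (S b - (r : ℂ) • b) + ((r : ℂ) - z) • b := by
        rw [sub_smul]; abel
      have h2 := h b hb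
      rw [h1] at h2
      have h3 := h2.trans (norm_add_le _ _)
      rw [norm_smul] at h3
      linarith
    have e : S (a + b) - (r : ℂ) • (a + b) = (S a - (r : ℂ) • a) + (S b - (r : ℂ) • b) := by
      rw [map_add, smul_add]; abel
    have h1 := norm_sq_add_of_mem_orthogonal ha hb
    have h2 := norm_sq_add_of_mem_orthogonal (W.sub_mem (hW a ha) (W.smul_mem (r : ℂ) ha))
      (Wᗮ.sub_mem (mem_orthogonal_of_invariant hS hW b hb) (Wᗮ.smul_mem (r : ℂ) hb))
    rw [e]
    refine le_of_sq_le_sq ?_ (norm_nonneg _)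
    rw [h2, mul_pow, h1, mul_add, ← mul_pow, ← mul_pow]
    gcongr
  refine ⟨R.finite_hasEigenvalue.subset key, fun w hw => ?_⟩
  obtain ⟨f, hf⟩ := (key w hw).exists_hasEigenvector
  refine Module.End.hasEigenvalue_of_hasEigenvector (x := (f : E))
    ⟨Module.End.mem_eigenspace_iff.2 ?_, fun h0 => hf.2 (Subtype.ext h0)⟩
  exact congrArg Subtype.val hf.apply_eq_smul

theorem mem_discreteSpectrum_of_gap (hS : IsSelfAdjoint S) (hW : ∀ f ∈ W, S f ∈ W) {z ε : ℝ}
    (hε : 0 < ε) (h : ∀ f ∈ Wᗮ, ε * ‖f‖ ≤ ‖S f - (z : ℂ) • f‖) (hz : (z : ℂ) ∈ spectrum ℂ S) :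
    (z : ℂ) ∈ discreteSpectrum S := by
  obtain ⟨hfin, hev⟩ := finite_spectrum_inter_ball hS hW h
  refine ⟨?_, hev _ ⟨Metric.mem_ball_self hε, hz⟩, ?_⟩
  · have hfin' : ((Metric.ball (z : ℂ) ε ∩ spectrum ℂ S) \ {(z : ℂ)}).Finite := hfin.sdiff
    obtain ⟨d, hd, hb⟩ := Metric.isOpen_iff.1 hfin'.isClosed.isOpen_compl (z : ℂ) (by simp)
    refine ⟨min d ε, lt_min hd hε, Set.eq_singleton_iff_unique_mem.2
      ⟨⟨Metric.mem_ball_self (lt_min hd hε), hz⟩, ?_⟩⟩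
    rintro w ⟨hw, hws⟩
    by_contra hne
    exact hb (Metric.ball_subset_ball (min_le_left _ _) hw)
      ⟨⟨Metric.ball_subset_ball (min_le_right _ _) hw, hws⟩, hne⟩
  · refine Submodule.finiteDimensional_of_le (S₂ := W) fun f hf => ?_
    rw [Module.End.mem_eigenspace_iff, ContinuousLinearMap.coe_coe, ← sub_eq_zero] at hf
    obtain ⟨a, ha, b, hb, rfl⟩ := W.exists_add_mem_mem_orthogonal f
    have e : S (a + b) - (z : ℂ) • (a + b) = (S a - (z : ℂ) • a) + (S b - (z : ℂ) • b) := by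
      rw [map_add, smul_add]; abel
    have h2 := norm_sq_add_of_mem_orthogonal (W.sub_mem (hW a ha) (W.smul_mem (z : ℂ) ha))
      (Wᗮ.sub_mem (mem_orthogonal_of_invariant hS hW b hb) (Wᗮ.smul_mem (z : ℂ) hb))
    rw [← e, hf, norm_zero] at h2
    have h3 := h b hb
    have h4 : ‖S b - (z : ℂ) • b‖ = 0 := by nlinarith [sq_nonneg ‖S a - (z : ℂ) • a‖]
    have h5 : ‖b‖ = 0 := by nlinarith [norm_nonneg b]
    rw [norm_eq_zero.1 h5, add_zero]
    exact ha

end Gap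

/-- The quadratic form of `S` is nonnegative up to arbitrarily small errors on subspaces of finite
codimension. -/
def EssentiallyNonneg (S : E →L[ℂ] E) : Prop :=
  ∀ δ > 0, ∃ F : Submodule ℂ E, FiniteDimensional ℂ F ∧
    ∀ f ∈ Fᗮ, -δ * ‖f‖ ^ 2 ≤ (inner ℂ f (S f)).re

/-- The given F need not be invariant. It is replaced by the range of the negative part of a = S +
δ, where the form of S is at most -δ‖f‖²; this range meets Fᗮ only in 0 and is thus
finite-dimensional. On its complement a agrees with its positive part. -/
theorem EssentiallyNonneg.exists_invariant {S : E →L[ℂ] E} (hS : IsSelfAdjoint S)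
    (h : EssentiallyNonneg S) {δ : ℝ} (hδ : 0 < δ) :
    ∃ W : Submodule ℂ E, FiniteDimensional ℂ W ∧ (∀ f ∈ W, S f ∈ W) ∧
      ∀ f ∈ Wᗮ, -δ * ‖f‖ ^ 2 ≤ (inner ℂ f (S f)).re := by
  -- Half of δ makes the two bounds on the form incompatible for f ≠ 0.
  obtain ⟨F, hF, hFS⟩ := h (δ / 2) (by positivity)
  set a : E →L[ℂ] E := S - algebraMap ℂ (E →L[ℂ] E) ((-δ : ℝ) : ℂ)
  have ha : IsSelfAdjoint a := isSelfAdjoint_sub_smul hS _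
  have hSa : ∀ f, S f = a f - (δ : ℂ) • f := fun f => by
    simp [a, Algebra.algebraMap_eq_smul_one]
  have hsplit : a⁺ - a⁻ = a := CFC.posPart_sub_negPart a ha
  have hpn : a⁺ * a⁻ = 0 := CFC.posPart_mul_negPart a
  have hnp : a⁻ * a⁺ = 0 := CFC.negPart_mul_posPart a
  have hpos := (ContinuousLinearMap.nonneg_iff_isPositive _).1 (CFC.posPart_nonneg a)
  have hneg := (ContinuousLinearMap.nonneg_iff_isPositive _).1 (CFC.negPart_nonneg a)
  have happ : ∀ f, a f = a⁺ f - a⁻ f := fun f => (congrArg (fun R : E →L[ℂ] E => R f) hsplit).symm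
  have haneg : ∀ f, a (a⁻ f) = -a⁻ (a⁻ f) := fun f => by
    have h1 : a⁺ (a⁻ f) = 0 := congrArg (fun R : E →L[ℂ] E => R f) hpn
    rw [happ, h1, zero_sub]
  have hnega : ∀ f, a⁻ (a f) = -a⁻ (a⁻ f) := fun f => by
    have h1 : a⁻ (a⁺ f) = 0 := congrArg (fun R : E →L[ℂ] E => R f) hnp
    rw [happ, map_sub, h1, zero_sub]
  have hform : ∀ f, (inner ℂ f (S f)).re = (inner ℂ f (a f)).re - δ * ‖f‖ ^ 2 := fun f => by
    rw [hSa, inner_sub_right, inner_smul_right, inner_self_eq_ofReal_norm_sq, Complex.sub_re,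
      ← Complex.ofReal_mul, Complex.ofReal_re]
  refine ⟨(a⁻ : E →L[ℂ] E).range, ?_, ?_, ?_⟩
  · by_contra hinf
    obtain ⟨f, ⟨g, rfl⟩, hf, h0⟩ :=
      exists_mem_orthogonal_of_not_finiteDimensional (N := F) hinf
    have h1 := hFS _ hf
    rw [hform] at h1
    simp only [ContinuousLinearMap.coe_coe] at h1 h0
    rw [haneg, inner_neg_right, Complex.neg_re] at h1
    have h2 := hneg.re_inner_nonneg_right (a⁻ g)
    simp only [RCLike.re_to_complex] at h2
    have h3 : 0 < ‖a⁻ g‖ ^ 2 := by positivity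
    nlinarith
  · rintro _ ⟨g, rfl⟩
    refine ⟨a g - (δ : ℂ) • g, ?_⟩
    simp only [ContinuousLinearMap.coe_coe]
    rw [hSa, haneg, map_sub, hnega, map_smul]
  · intro f hf
    have h0 : a⁻ f = 0 := by
      rw [← inner_self_eq_zero (𝕜 := ℂ)]
      have h1 := hf (a⁻ (a⁻ f)) ⟨_, rfl⟩
      exact (hneg.isSymmetric (a⁻ f) f).symm.trans h1
    have h1 : a f = a⁺ f := by rw [happ, h0, sub_zero]
    rw [hform, h1]
    have h2 := hpos.re_inner_nonneg_right f
    simp only [RCLike.re_to_complex] at h2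
    linarith

/-- Polarization: the form is compared at f + g and f - g with g = r⁻¹ D f, which stay in X by
invariance, and the parallelogram law finishes. -/
theorem norm_le_of_abs_form_le {D : E →L[ℂ] E} (hD : IsSelfAdjoint D) {X : Submodule ℂ E}
    (hX : ∀ f ∈ X, D f ∈ X) {r : ℝ} (hr : 0 < r)
    (h : ∀ f ∈ X, |(inner ℂ f (D f)).re| ≤ r * ‖f‖ ^ 2) : ∀ f ∈ X, ‖D f‖ ≤ r * ‖f‖ := by
  intro f hf
  set g := ((r⁻¹ : ℝ) : ℂ) • D f
  have hg : g ∈ X := X.smul_mem _ (hX f hf)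
  have h1 := (abs_le.1 (h _ (X.add_mem hf hg))).2
  have h2 := (abs_le.1 (h _ (X.sub_mem hf hg))).1
  have h3 := parallelogram_law_with_norm ℂ f g
  have e1 : inner ℂ f (D g) = ((r⁻¹ * ‖D f‖ ^ 2 : ℝ) : ℂ) := by
    rw [← ContinuousLinearMap.coe_coe, ← hD.isSymmetric, ContinuousLinearMap.coe_coe,
      inner_smul_right, inner_self_eq_ofReal_norm_sq, Complex.ofReal_mul]
  have e2 : inner ℂ g (D f) = ((r⁻¹ * ‖D f‖ ^ 2 : ℝ) : ℂ) := by
    rw [inner_smul_left, inner_self_eq_ofReal_norm_sq, Complex.conj_ofReal,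
      Complex.ofReal_mul]
  have e3 : (inner ℂ (f + g) (D (f + g))).re - (inner ℂ (f - g) (D (f - g))).re
      = 4 * (r⁻¹ * ‖D f‖ ^ 2) := by
    simp only [map_add, map_sub, inner_add_left, inner_add_right, inner_sub_left,
      inner_sub_right, e1, e2, Complex.add_re, Complex.sub_re, Complex.ofReal_re]
    ring
  have e4 : ‖g‖ = r⁻¹ * ‖D f‖ := by
    rw [norm_smul, Complex.norm_real, Real.norm_of_nonneg (by positivity)]
  rw [e4] at h3
  have h5 : 4 * (r⁻¹ * ‖D f‖ ^ 2) ≤ r * (2 * (‖f‖ * ‖f‖ + r⁻¹ * ‖D f‖ * (r⁻¹ * ‖D f‖))) := by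
    nlinarith
  have h6 : r * (2 * (‖f‖ * ‖f‖ + r⁻¹ * ‖D f‖ * (r⁻¹ * ‖D f‖)))
      = 2 * r * ‖f‖ ^ 2 + 2 * (r⁻¹ * ‖D f‖ ^ 2) := by
    field_simp
  rw [h6] at h5
  have h7 : r⁻¹ * ‖D f‖ ^ 2 ≤ r * ‖f‖ ^ 2 := by linarith
  rw [inv_mul_eq_div, div_le_iff₀ hr] at h7
  refine le_of_sq_le_sq ?_ (by positivity)
  linarith [mul_pow r ‖f‖ 2]

end SelfAdjoint

/-! ### Operators on a Hilbert space tensor product -/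

section Tensor

set_option linter.unusedSectionVars false

theorem _root_.HilbertBasis.hasSum_norm_sq_inner {ι F : Type*} [NormedAddCommGroup F]
    [InnerProductSpace ℂ F] [CompleteSpace F] (b : HilbertBasis ι ℂ F) (x : F) :
    HasSum (fun i => ‖inner ℂ (b i) x‖ ^ 2) (‖x‖ ^ 2) := by
  have h1 := b.hasSum_inner_mul_inner x x
  rw [inner_self_eq_ofReal_norm_sq] at h1
  have e : (fun i => inner ℂ x (b i) * inner ℂ (b i) x)
      = fun i => ((‖inner ℂ (b i) x‖ ^ 2 : ℝ) : ℂ) := by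
    ext i
    rw [← inner_conj_symm x (b i), Complex.conj_mul', Complex.ofReal_pow]
  rw [e] at h1
  exact Complex.hasSum_ofReal.1 h1

theorem _root_.HilbertBasis.eq_zero_of_forall_inner {ι F : Type*} [NormedAddCommGroup F]
    [InnerProductSpace ℂ F] [CompleteSpace F] (b : HilbertBasis ι ℂ F) {x : F}
    (hx : ∀ i, inner ℂ (b i) x = 0) : x = 0 := by
  have h1 := b.hasSum_norm_sq_inner x
  simp only [hx, norm_zero, ne_eq, OfNat.ofNat_ne_zero, not_false_eq_true, zero_pow] at h1
  simpa using h1.unique hasSum_zero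

variable {E₁ E₂ G : Type*} [NormedAddCommGroup E₁] [InnerProductSpace ℂ E₁]
  [NormedAddCommGroup E₂] [InnerProductSpace ℂ E₂]
  [NormedAddCommGroup G] [InnerProductSpace ℂ G]

/-- The bilinear map `tp` exhibits `G` as the Hilbert space tensor product of `E₁` and `E₂`. -/
structure IsHilbertTensor (tp : E₁ →ₗ[ℂ] E₂ →ₗ[ℂ] G) : Prop where
  inner_eq : ∀ a b c d, inner ℂ (tp a b) (tp c d) = inner ℂ a c * inner ℂ b d
  eq_zero : ∀ g, (∀ a b, inner ℂ (tp a b) g = 0) → g = 0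

namespace IsHilbertTensor

variable {tp : E₁ →ₗ[ℂ] E₂ →ₗ[ℂ] G}

theorem flip (h : IsHilbertTensor tp) : IsHilbertTensor tp.flip where
  inner_eq a b c d := by
    rw [LinearMap.flip_apply, LinearMap.flip_apply, h.inner_eq, mul_comm]
  eq_zero g hg := h.eq_zero g fun a b => hg b a

theorem norm_apply (h : IsHilbertTensor tp) (a : E₁) (b : E₂) : ‖tp a b‖ = ‖a‖ * ‖b‖ := by
  have h1 := h.inner_eq a b a b
  rw [inner_self_eq_norm_sq_to_K, inner_self_eq_norm_sq_to_K, inner_self_eq_norm_sq_to_K] at h1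
  have h2 : ‖tp a b‖ ^ 2 = (‖a‖ * ‖b‖) ^ 2 := by
    rw [mul_pow]
    exact_mod_cast h1
  exact (sq_eq_sq₀ (norm_nonneg _) (by positivity)).1 h2

theorem ext_inner (h : IsHilbertTensor tp) {f g : G}
    (hfg : ∀ a b, inner ℂ (tp a b) f = inner ℂ (tp a b) g) : f = g :=
  sub_eq_zero.1 <| h.eq_zero _ fun a b => by rw [inner_sub_right, hfg, sub_self]

variable [CompleteSpace E₁] [CompleteSpace E₂] [CompleteSpace G]

/-- Simple tensors are total, so the adjoint of A is determined on them, where it also acts as S. -/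
theorem isSelfAdjoint_lift (h : IsHilbertTensor tp) {S : E₁ →L[ℂ] E₁} (hS : IsSelfAdjoint S)
    {A : G →L[ℂ] G} (hA : ∀ a b, A (tp a b) = tp (S a) b) : IsSelfAdjoint A := by
  have hadj : ∀ a b, A.adjoint (tp a b) = tp (S a) b := fun a b => h.ext_inner fun c d => by
    rw [ContinuousLinearMap.adjoint_inner_right, hA, h.inner_eq, h.inner_eq]
    exact congrArg (· * _) (hS.isSymmetric c a)
  rw [ContinuousLinearMap.isSelfAdjoint_iff']
  refine ContinuousLinearMap.ext fun g => h.ext_inner fun a b => ?_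
  rw [ContinuousLinearMap.adjoint_inner_right, hA, ← hadj,
    ContinuousLinearMap.adjoint_inner_left]

/-- The adjoint of `a ↦ a ⊗ b`. -/
def contract (h : IsHilbertTensor tp) (b : E₂) : G →L[ℂ] E₁ :=
  ((tp.flip b).mkContinuous ‖b‖ fun a => by
    rw [LinearMap.flip_apply, h.norm_apply, mul_comm]).adjoint

theorem inner_contract (h : IsHilbertTensor tp) (a : E₁) (b : E₂) (f : G) :
    inner ℂ a (h.contract b f) = inner ℂ (tp a b) f := by
  rw [contract, ContinuousLinearMap.adjoint_inner_right]
  rfl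

theorem contract_lift (h : IsHilbertTensor tp) {S : E₁ →L[ℂ] E₁} (hS : IsSelfAdjoint S)
    {A : G →L[ℂ] G} (hA : ∀ a b, A (tp a b) = tp (S a) b) (b : E₂) (f : G) :
    h.contract b (A f) = S (h.contract b f) := by
  refine ext_inner_left ℂ fun a => ?_
  rw [h.inner_contract]
  have h1 := (h.isSelfAdjoint_lift hS hA).isSymmetric (tp a b) f
  have h2 := hS.isSymmetric a (h.contract b f)
  simp only [ContinuousLinearMap.coe_coe] at h1 h2
  rw [← h1, ← h2, hA, h.inner_contract]

/-- Parseval for the product of two Hilbert bases, grouped by the second factor. It lets norm bounds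
for S pass to its lift slice by slice. -/
theorem hasSum_norm_sq_contract (h : IsHilbertTensor tp) {ι : Type*} (e : HilbertBasis ι ℂ E₂)
    (f : G) : HasSum (fun j => ‖h.contract (e j) f‖ ^ 2) (‖f‖ ^ 2) := by
  obtain ⟨w, e₁, -⟩ := exists_hilbertBasis ℂ E₁
  have hon : Orthonormal ℂ (fun p : ι × w => tp (e₁ p.2) (e p.1)) := by
    classical
    rw [orthonormal_iff_ite]
    rintro ⟨j, i⟩ ⟨j', i'⟩
    rw [h.inner_eq, orthonormal_iff_ite.1 e₁.orthonormal, orthonormal_iff_ite.1 e.orthonormal]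
    simp only [Prod.mk.injEq]
    split_ifs <;> simp_all
  have hbot : (Submodule.span ℂ (Set.range fun p : ι × w => tp (e₁ p.2) (e p.1)))ᗮ = ⊥ := by
    rw [Submodule.eq_bot_iff]
    intro g hg
    have h0 : ∀ i j, inner ℂ (tp (e₁ i) (e j)) g = 0 := fun i j =>
      hg _ (Submodule.subset_span ⟨(j, i), rfl⟩)
    have h1 : ∀ j, h.contract (e j) g = 0 := fun j =>
      e₁.eq_zero_of_forall_inner fun i => by rw [h.inner_contract, h0]
    refine h.eq_zero g fun a b => ?_
    have h2 : h.flip.contract a g = 0 := e.eq_zero_of_forall_inner fun j => by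
      rw [h.flip.inner_contract, LinearMap.flip_apply, ← h.inner_contract, h1, inner_zero_right]
    have h3 := h.flip.inner_contract b a g
    rw [h2, inner_zero_right, LinearMap.flip_apply] at h3
    exact h3.symm
  have h1 := (HilbertBasis.mkOfOrthogonalEqBot hon hbot).hasSum_norm_sq_inner f
  rw [HilbertBasis.coe_mkOfOrthogonalEqBot] at h1
  refine h1.prod_fiberwise fun j => ?_
  have h2 := e₁.hasSum_norm_sq_inner (h.contract (e j) f)
  simpa only [h.inner_contract] using h2

theorem norm_lift_le (h : IsHilbertTensor tp) {S : E₁ →L[ℂ] E₁} (hS : IsSelfAdjoint S)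
    {A : G →L[ℂ] G} (hA : ∀ a b, A (tp a b) = tp (S a) b) {W : Submodule ℂ E₁} {r : ℝ}
    (hr : 0 ≤ r) (hW : ∀ a ∈ Wᗮ, ‖S a‖ ≤ r * ‖a‖) {f : G}
    (hf : ∀ a ∈ W, ∀ b, inner ℂ (tp a b) f = 0) : ‖A f‖ ≤ r * ‖f‖ := by
  obtain ⟨w, e, -⟩ := exists_hilbertBasis ℂ E₂
  refine le_of_sq_le_sq ?_ (by positivity)
  rw [mul_pow]
  refine hasSum_le (fun j => ?_) (h.hasSum_norm_sq_contract e (A f))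
    ((h.hasSum_norm_sq_contract e f).mul_left (r ^ 2))
  rw [h.contract_lift hS hA, ← mul_pow]
  -- Orthogonality of f to W ⊗ E₂ means that every slice lies in Wᗮ.
  have : h.contract (e j) f ∈ Wᗮ := fun a ha => by rw [h.inner_contract, hf a ha]
  gcongr
  exact hW _ this

theorem le_norm_lift (h : IsHilbertTensor tp) {S : E₁ →L[ℂ] E₁} (hS : IsSelfAdjoint S)
    {A : G →L[ℂ] G} (hA : ∀ a b, A (tp a b) = tp (S a) b) {d : ℝ} (hd : 0 ≤ d)
    (hdS : ∀ a, d * ‖a‖ ≤ ‖S a‖) (f : G) : d * ‖f‖ ≤ ‖A f‖ := by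
  obtain ⟨w, e, -⟩ := exists_hilbertBasis ℂ E₂
  refine le_of_sq_le_sq ?_ (by positivity)
  rw [mul_pow]
  refine hasSum_le (fun j => ?_) ((h.hasSum_norm_sq_contract e f).mul_left (d ^ 2))
    (h.hasSum_norm_sq_contract e (A f))
  rw [h.contract_lift hS hA, ← mul_pow]
  gcongr
  exact hdS _

variable {S₁ : E₁ →L[ℂ] E₁} {S₂ : E₂ →L[ℂ] E₂} {A B : G →L[ℂ] G}

/-- On Wᗮ the form of S₁ lies in [-d, M], so S₁ is within r = (M + d)/2 of the midpoint c = (M -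
d)/2. By the gap, σ(S₂) stays r + d away from z - c. The triangle inequality leaves d. -/
theorem boundedBelow_of_orthogonal (h : IsHilbertTensor tp)
    (hS₁ : IsSelfAdjoint S₁) (hS₂ : IsSelfAdjoint S₂)
    (hA : ∀ a b, A (tp a b) = tp (S₁ a) b) (hB : ∀ a b, B (tp a b) = tp a (S₂ b))
    {W : Submodule ℂ E₁} (hW : ∀ a ∈ W, S₁ a ∈ W) {z M d : ℝ} (hd : 0 < d) (hM : 0 ≤ M)
    (hlow : ∀ a ∈ Wᗮ, -d * ‖a‖ ^ 2 ≤ (inner ℂ a (S₁ a)).re)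
    (hup : ∀ a, (inner ℂ a (S₁ a)).re ≤ M * ‖a‖ ^ 2)
    (hz : ∀ t : ℝ, (t : ℂ) ∈ spectrum ℂ S₂ → z - t ≤ -(2 * d) ∨ M + 2 * d ≤ z - t)
    {f : G} (hf : ∀ a ∈ W, ∀ b, inner ℂ (tp a b) f = 0) :
    d * ‖f‖ ≤ ‖(A + B) f - (z : ℂ) • f‖ := by
  set c := (M - d) / 2 with hc
  set r := (M + d) / 2 with hr
  have hr0 : 0 < r := by positivity
  have h1 : ‖(A - algebraMap ℂ (G →L[ℂ] G) (c : ℂ)) f‖ ≤ r * ‖f‖ := by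
    refine h.norm_lift_le (isSelfAdjoint_sub_smul hS₁ c) (fun a b => ?_) hr0.le (W := W) ?_ hf
    · simp [Algebra.algebraMap_eq_smul_one, hA]
    · refine norm_le_of_abs_form_le (isSelfAdjoint_sub_smul hS₁ c) (fun a ha => ?_) hr0
        fun a ha => ?_
      · have := Wᗮ.sub_mem (mem_orthogonal_of_invariant hS₁ hW a ha) (Wᗮ.smul_mem (c : ℂ) ha)
        simpa [Algebra.algebraMap_eq_smul_one] using this
      · have e : (inner ℂ a ((S₁ - algebraMap ℂ (E₁ →L[ℂ] E₁) (c : ℂ)) a)).re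
            = (inner ℂ a (S₁ a)).re - c * ‖a‖ ^ 2 := by
          have : (S₁ - algebraMap ℂ (E₁ →L[ℂ] E₁) (c : ℂ)) a = S₁ a - (c : ℂ) • a := by
            simp [Algebra.algebraMap_eq_smul_one]
          rw [this, inner_sub_right, inner_smul_right, inner_self_eq_ofReal_norm_sq,
            Complex.sub_re, ← Complex.ofReal_mul, Complex.ofReal_re]
        have := hlow a ha
        have := hup a
        rw [e, abs_le, hr, hc]
        constructor <;> linarith
  have h2 : (r + d) * ‖f‖ ≤ ‖(B - algebraMap ℂ (G →L[ℂ] G) ((z - c : ℝ) : ℂ)) f‖ := by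
    refine h.flip.le_norm_lift (isSelfAdjoint_sub_smul hS₂ (z - c)) (fun b a => ?_)
      (by positivity) (fun b => ?_) f
    · simp [Algebra.algebraMap_eq_smul_one, hB]
    · have := le_norm_apply_sub_of_le_dist hS₂ (w := ((z - c : ℝ) : ℂ)) (d := r + d)
        (by positivity) (fun t ht => ?_) b
      · simpa [Algebra.algebraMap_eq_smul_one] using this
      · obtain ⟨s, rfl⟩ := exists_real_of_mem_spectrum hS₂ ht
        rw [← Complex.ofReal_sub, Complex.norm_real, Real.norm_eq_abs, le_abs, hr, hc]
        rcases hz s ht with h | h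
        · left; linarith
        · right; linarith
  have e : (A + B) f - (z : ℂ) • f = (B - algebraMap ℂ (G →L[ℂ] G) ((z - c : ℝ) : ℂ)) f
      - -((A - algebraMap ℂ (G →L[ℂ] G) (c : ℂ)) f) := by
    simp only [Algebra.algebraMap_eq_smul_one, add_apply, sub_apply, smul_apply,
      one_apply_eq_self, Complex.ofReal_sub, sub_smul]
    abel
  rw [e]
  have h3 := norm_sub_norm_le ((B - algebraMap ℂ (G →L[ℂ] G) ((z - c : ℝ) : ℂ)) f)
    (-((A - algebraMap ℂ (G →L[ℂ] G) (c : ℂ)) f))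
  rw [norm_neg] at h3
  linarith

-- The sum of a compact and a closed set is closed, so z has a positive distance ε from it, and d₀ =
-- ε/2 works.
open scoped Pointwise in
theorem exists_gap {S : E₁ →L[ℂ] E₁} {z M : ℝ} (hM : 0 ≤ M)
    (hz : ∀ s ∈ Set.Icc 0 M, ∀ t : ℝ, (t : ℂ) ∈ spectrum ℂ S → z ≠ s + t) :
    ∃ d₀ > 0, ∀ d ≤ d₀, ∀ t : ℝ, (t : ℂ) ∈ spectrum ℂ S →
      z - t ≤ -(2 * d) ∨ M + 2 * d ≤ z - t := by
  have hcl : IsClosed {t : ℝ | (t : ℂ) ∈ spectrum ℂ S} :=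
    (spectrum.isClosed S).preimage Complex.continuous_ofReal
  have hcl' : IsClosed (Set.Icc 0 M + {t : ℝ | (t : ℂ) ∈ spectrum ℂ S}) :=
    hcl.add_left_of_isCompact isCompact_Icc
  have hzc : z ∉ Set.Icc 0 M + {t : ℝ | (t : ℂ) ∈ spectrum ℂ S} := by
    rintro ⟨s, hs, t, ht, hst⟩
    exact hz s hs t ht hst.symm
  obtain ⟨ε, hε, hb⟩ := Metric.isOpen_iff.1 hcl'.isOpen_compl z hzc
  have key : ∀ s ∈ Set.Icc 0 M, ∀ t : ℝ, (t : ℂ) ∈ spectrum ℂ S → ε ≤ |s + t - z| := by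
    intro s hs t ht
    by_contra! hlt
    exact hb (show s + t ∈ Metric.ball z ε by rwa [Metric.mem_ball, Real.dist_eq])
      ⟨s, hs, t, ht, rfl⟩
  refine ⟨ε / 2, by positivity, fun d hd t ht => ?_⟩
  have hzt := hz (z - t)
  have k0 := key 0 ⟨le_rfl, hM⟩ t ht
  have kM := key M ⟨hM, le_rfl⟩ t ht
  rcases lt_or_ge (z - t) 0 with h | h
  · left
    rw [abs_of_pos (by linarith)] at k0
    linarith
  · rcases le_or_gt (z - t) M with h' | h'
    · exact absurd (sub_add_cancel z t).symm (hzt ⟨h, h'⟩ t ht)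
    · right
      rw [abs_of_neg (by linarith)] at kM
      linarith

theorem mem_discreteSpectrum (h : IsHilbertTensor tp)
    (hS₁ : IsSelfAdjoint S₁) (hS₂ : IsSelfAdjoint S₂)
    (hA : ∀ a b, A (tp a b) = tp (S₁ a) b) (hB : ∀ a b, B (tp a b) = tp a (S₂ b))
    (hess₁ : EssentiallyNonneg S₁) (hess₂ : EssentiallyNonneg S₂)
    {z M₁ M₂ : ℝ} (hM₁ : 0 ≤ M₁) (hM₂ : 0 ≤ M₂)
    (hup₁ : ∀ a, (inner ℂ a (S₁ a)).re ≤ M₁ * ‖a‖ ^ 2)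
    (hup₂ : ∀ a, (inner ℂ a (S₂ a)).re ≤ M₂ * ‖a‖ ^ 2)
    (hz₁ : ∀ s ∈ Set.Icc 0 M₁, ∀ t : ℝ, (t : ℂ) ∈ spectrum ℂ S₂ → z ≠ s + t)
    (hz₂ : ∀ s ∈ Set.Icc 0 M₂, ∀ t : ℝ, (t : ℂ) ∈ spectrum ℂ S₁ → z ≠ s + t)
    (hz : (z : ℂ) ∈ spectrum ℂ (A + B)) : (z : ℂ) ∈ discreteSpectrum (A + B) := by
  obtain ⟨d₁, hd₁, hgap₁⟩ := exists_gap hM₁ hz₁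
  obtain ⟨d₂, hd₂, hgap₂⟩ := exists_gap hM₂ hz₂
  set d := min d₁ d₂
  have hd : 0 < d := lt_min hd₁ hd₂
  obtain ⟨W₁, hW₁f, hW₁, hlow₁⟩ := hess₁.exists_invariant hS₁ hd
  obtain ⟨W₂, hW₂f, hW₂, hlow₂⟩ := hess₂.exists_invariant hS₂ hd
  have hT : IsSelfAdjoint (A + B) :=
    (h.isSelfAdjoint_lift hS₁ hA).add (h.flip.isSelfAdjoint_lift hS₂ fun b a => hB a b)
  have hTtp : ∀ a b, (A + B) (tp a b) = tp (S₁ a) b + tp a (S₂ b) := fun a b => by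
    rw [add_apply, hA, hB]
  set W : Submodule ℂ G := Submodule.map₂ tp W₁ W₂
  have hWf : FiniteDimensional ℂ W := by
    rw [← Submodule.fg_iff_finiteDimensional] at hW₁f hW₂f ⊢
    exact hW₁f.map₂ tp hW₂f
  have inv : ∀ U : Submodule ℂ E₂, (∀ b ∈ U, S₂ b ∈ U) →
      ∀ f ∈ Submodule.map₂ tp W₁ U, (A + B) f ∈ Submodule.map₂ tp W₁ U := by
    intro U hU f hf
    have : Submodule.map₂ tp W₁ U ≤ (Submodule.map₂ tp W₁ U).comap ((A + B : G →L[ℂ] G) : G →ₗ[ℂ] G) :=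
      Submodule.map₂_le.2 fun a ha b hb => by
        rw [Submodule.mem_comap, ContinuousLinearMap.coe_coe, hTtp]
        exact Submodule.add_mem _ (Submodule.apply_mem_map₂ _ (hW₁ a ha) hb)
          (Submodule.apply_mem_map₂ _ ha (hU b hb))
    exact this hf
  refine mem_discreteSpectrum_of_gap (W := W) hT (inv W₂ hW₂) hd (fun f hf => ?_) hz
  -- G splits into X, the complement of W₁ ⊗ E₂, and Xᗮ, both invariant. The component f₁ in X is
  -- handled through W₁, the component f₂ in Xᗮ through W₂.
  set X : Submodule ℂ G := (Submodule.map₂ tp W₁ ⊤)ᗮ with hX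
  have hXinv := mem_orthogonal_of_invariant hT (inv ⊤ fun _ _ => Submodule.mem_top)
  have hXinv' := mem_orthogonal_of_invariant hT hXinv
  have hXmem : ∀ g, g ∈ X ↔ ∀ a ∈ W₁, ∀ b, inner ℂ (tp a b) g = 0 := by
    intro g
    constructor
    · exact fun hg a ha b => hg _ (Submodule.apply_mem_map₂ _ ha Submodule.mem_top)
    · intro hg
      have : Submodule.map₂ tp W₁ ⊤ ≤ (Submodule.span ℂ {g})ᗮ :=
        Submodule.map₂_le.2 fun a ha b _ =>
          Submodule.mem_orthogonal_singleton_iff_inner_left.2 (hg a ha b)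
      exact fun x hx => Submodule.mem_orthogonal_singleton_iff_inner_left.1 (this hx)
  obtain ⟨f₁, hf₁, f₂, hf₂, rfl⟩ := X.exists_add_mem_mem_orthogonal f
  have hlow₁' : d * ‖f₁‖ ≤ ‖(A + B) f₁ - (z : ℂ) • f₁‖ :=
    h.boundedBelow_of_orthogonal hS₁ hS₂ hA hB hW₁ hd hM₁ hlow₁ hup₁
      (hgap₁ d (min_le_left _ _)) ((hXmem f₁).1 hf₁)
  have hlow₂' : d * ‖f₂‖ ≤ ‖(A + B) f₂ - (z : ℂ) • f₂‖ := by
    have := h.flip.boundedBelow_of_orthogonal (A := B) (B := A) hS₂ hS₁ (fun b a => hB a b)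
      (fun b a => hA a b) hW₂ hd hM₂ hlow₂ hup₂ (hgap₂ d (min_le_right _ _)) (f := f₂) ?_
    · rwa [add_comm B A] at this
    · intro b hb a
      rw [LinearMap.flip_apply]
      -- f₂ is orthogonal to W₁ ⊗ W₂ because f and f₁ are, and to W₁ᗮ ⊗ W₂ because that lies in X.
      obtain ⟨a₁, ha₁, a₂, ha₂, rfl⟩ := W₁.exists_add_mem_mem_orthogonal a
      rw [map_add, LinearMap.add_apply, inner_add_left]
      have k1 : inner ℂ (tp a₁ b) f₂ = 0 := by
        have h1 := hf _ (Submodule.apply_mem_map₂ tp ha₁ hb)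
        rwa [inner_add_right, (hXmem f₁).1 hf₁ a₁ ha₁ b, zero_add] at h1
      have k2 : inner ℂ (tp a₂ b) f₂ = 0 := by
        refine hf₂ _ ((hXmem _).2 fun a' ha' b' => ?_)
        rw [h.inner_eq, ha₂ a' ha', zero_mul]
      rw [k1, k2, add_zero]
  have e : (A + B) (f₁ + f₂) - (z : ℂ) • (f₁ + f₂)
      = ((A + B) f₁ - (z : ℂ) • f₁) + ((A + B) f₂ - (z : ℂ) • f₂) := by
    rw [map_add, smul_add]; abel
  have h2 := norm_sq_add_of_mem_orthogonal
    (X.sub_mem (hXinv f₁ hf₁) (X.smul_mem (z : ℂ) hf₁))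
    (Xᗮ.sub_mem (hXinv' f₂ hf₂) (Xᗮ.smul_mem (z : ℂ) hf₂))
  rw [e]
  refine le_of_sq_le_sq ?_ (norm_nonneg _)
  rw [h2, mul_pow, norm_sq_add_of_mem_orthogonal hf₁ hf₂, mul_add, ← mul_pow, ← mul_pow]
  gcongr

/-- For a fixed approximate eigenvector b of S₂, the map a ↦ a ⊗ b scales norms by ‖b‖ ≠ 0, so V
keeps its dimension, and the two errors add. -/
theorem hasSingularSubspaces_add (h : IsHilbertTensor tp) (hS₂ : IsSelfAdjoint S₂)
    (hA : ∀ a b, A (tp a b) = tp (S₁ a) b) (hB : ∀ a b, B (tp a b) = tp a (S₂ b)) {s t : ℝ}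
    (hs : HasSingularSubspaces S₁ s) (ht : (t : ℂ) ∈ spectrum ℂ S₂) :
    HasSingularSubspaces (A + B) ((s + t : ℝ) : ℂ) := by
  intro ε hε
  obtain ⟨V, hV, hVS⟩ := hs (ε / 2) (by positivity)
  obtain ⟨b, hb, hbS⟩ := exists_approx_of_mem_spectrum hS₂ ht (ε := ε / 2) (by positivity)
  refine ⟨V.map (tp.flip b), fun hfin => hV ?_, ?_⟩
  · have hinj : Function.Injective (tp.flip b) := by
      rw [← LinearMap.ker_eq_bot, LinearMap.ker_eq_bot']
      intro a ha
      have h1 : ‖tp a b‖ = 0 := by rw [← LinearMap.flip_apply, ha, norm_zero]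
      rw [h.norm_apply] at h1
      exact norm_eq_zero.1 ((mul_eq_zero.1 h1).resolve_right (norm_ne_zero_iff.2 hb))
    exact (Submodule.equivMapOfInjective _ hinj V).symm.finiteDimensional
  · rintro _ ⟨a, ha, rfl⟩
    rw [LinearMap.flip_apply]
    have e : (A + B) (tp a b) - ((s + t : ℝ) : ℂ) • tp a b
        = tp (S₁ a - (s : ℂ) • a) b + tp a (S₂ b - (t : ℂ) • b) := by
      rw [add_apply, hA, hB, map_sub, map_sub, LinearMap.sub_apply, map_smul, map_smul,
        LinearMap.smul_apply, Complex.ofReal_add, add_smul]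
      abel
    rw [e]
    refine (norm_add_le _ _).trans ?_
    rw [h.norm_apply, h.norm_apply, h.norm_apply]
    have h1 := mul_le_mul_of_nonneg_right (hVS a ha) (norm_nonneg b)
    have h2 := mul_le_mul_of_nonneg_left hbS (norm_nonneg a)
    linarith

end IsHilbertTensor

end Tensor

/-! ### The negative spectrum of an essentially nonnegative operator -/

section NegativeSpectrum

variable {E : Type*} [NormedAddCommGroup E] [InnerProductSpace ℂ E] [CompleteSpace E]
  {S : E →L[ℂ] E}

theorem le_norm_apply_sub_of_le_form {c z : ℝ} {f : E}
    (h : c * ‖f‖ ^ 2 ≤ (inner ℂ f (S f)).re) : (c - z) * ‖f‖ ≤ ‖S f - (z : ℂ) • f‖ := by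
  have h1 : (inner ℂ f (S f - (z : ℂ) • f)).re = (inner ℂ f (S f)).re - z * ‖f‖ ^ 2 := by
    rw [inner_sub_right, inner_smul_right, inner_self_eq_ofReal_norm_sq, Complex.sub_re,
      ← Complex.ofReal_mul, Complex.ofReal_re]
  have h2 := re_inner_le_norm (𝕜 := ℂ) f (S f - (z : ℂ) • f)
  rw [RCLike.re_to_complex, h1] at h2
  rcases (norm_nonneg f).eq_or_lt with h0 | h0
  · rw [← h0]; simp
  · refine le_of_mul_le_mul_left ?_ h0
    nlinarith

theorem norm_apply_sub_ge_of_form_le {c z : ℝ} {f : E}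
    (h : (inner ℂ f (S f)).re ≤ c * ‖f‖ ^ 2) : (z - c) * ‖f‖ ≤ ‖S f - (z : ℂ) • f‖ := by
  have h1 := le_norm_apply_sub_of_le_form (S := -S) (c := -c) (z := -z) (f := f) (by
    rw [neg_apply, inner_neg_right, Complex.neg_re]
    linarith)
  rwa [neg_apply, Complex.ofReal_neg, neg_smul, neg_sub_neg, neg_sub_neg, norm_sub_rev] at h1

theorem le_of_mem_spectrum (hS : IsSelfAdjoint S) {M t : ℝ}
    (hup : ∀ f, (inner ℂ f (S f)).re ≤ M * ‖f‖ ^ 2) (ht : (t : ℂ) ∈ spectrum ℂ S) : t ≤ M := by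
  by_contra! hlt
  exact notMem_spectrum_of_boundedBelow hS (sub_pos.2 hlt)
    (fun f => norm_apply_sub_ge_of_form_le (hup f)) ht

theorem EssentiallyNonneg.mem_discreteSpectrum (hS : IsSelfAdjoint S) (h : EssentiallyNonneg S)
    {t : ℝ} (ht0 : t < 0) (ht : (t : ℂ) ∈ spectrum ℂ S) : (t : ℂ) ∈ discreteSpectrum S := by
  -- Off W the form is at least t/2, which leaves a gap of -t/2 > 0 above t.
  obtain ⟨W, hWf, hW, hlow⟩ := h.exists_invariant hS (δ := -t / 2) (by linarith)
  refine mem_discreteSpectrum_of_gap hS hW (ε := -(-t / 2) - t) (by linarith) (fun f hf => ?_) ht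
  exact le_norm_apply_sub_of_le_form (hlow f hf)

theorem EssentiallyNonneg.finite_spectrum_lt (hS : IsSelfAdjoint S) (h : EssentiallyNonneg S)
    {δ : ℝ} (hδ : 0 < δ) : {t : ℝ | (t : ℂ) ∈ spectrum ℂ S ∧ t < -δ}.Finite := by
  obtain ⟨W, hWf, hW, hlow⟩ := h.exists_invariant hS hδ
  set R := ‖S‖ * ‖(1 : E →L[ℂ] E)‖
  have hR : 0 ≤ R := by positivity
  -- This ball has radius R and right end -δ; it contains [-R, -δ), hence all of the spectrum below
  -- -δ.
  have hfin := (finite_spectrum_inter_ball hS hW (z := -R - δ) (ε := -δ - (-R - δ))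
    fun f hf => le_norm_apply_sub_of_le_form (hlow f hf)).1
  refine Set.Finite.of_finite_image (f := ((↑) : ℝ → ℂ)) (hfin.subset ?_)
    Complex.ofReal_injective.injOn
  rintro _ ⟨t, ⟨ht, htδ⟩, rfl⟩
  refine ⟨?_, ht⟩
  have h1 := spectrum.subset_closedBall_norm_mul S ht
  rw [mem_closedBall_zero_iff, Complex.norm_real, Real.norm_eq_abs] at h1
  have h2 := (abs_le.1 h1).1
  rw [Metric.mem_ball, dist_eq_norm, ← Complex.ofReal_sub, Complex.norm_real, Real.norm_eq_abs,
    abs_lt]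
  constructor <;> linarith

end NegativeSpectrum

open scoped Pointwise in
/-- The sum of `[0, M]` and a closed set whose part in `(-∞, -M)` is finite is a finite union of
intervals. -/
theorem exists_finset_Icc_add {M N : ℝ} (hM : 0 ≤ M) (hN : 0 ≤ N) {s : Set ℝ} (hs : IsClosed s)
    (hup : ∀ t ∈ s, t ≤ N) (hsub : Set.Icc 0 N ⊆ s) (hfin : {t | t ∈ s ∧ t < -M}.Finite) :
    ∃ P : Finset (ℝ × ℝ), P.Nonempty ∧ (∀ p ∈ P, p.1 ≤ p.2) ∧ (0 < M → ∀ p ∈ P, p.1 < p.2) ∧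
      Set.Icc 0 M + s = ⋃ p ∈ P, Set.Icc p.1 p.2 := by
  classical
  have hcpt : IsCompact (Set.Icc (-M) 0 ∩ s) := isCompact_Icc.inter_right hs
  have h0 : (0 : ℝ) ∈ s := hsub ⟨le_rfl, hN⟩
  obtain ⟨a, ⟨⟨haM, ha0⟩, has⟩, hmin⟩ := hcpt.exists_isMinOn (f := id)
    ⟨0, ⟨by linarith, le_rfl⟩, h0⟩ continuousOn_id
  have hmin' : ∀ t ∈ s, -M ≤ t → a ≤ t := by
    intro t ht htM
    rcases le_total t 0 with h | h
    · exact hmin (⟨⟨htM, h⟩, ht⟩ : t ∈ Set.Icc (-M) 0 ∩ s)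
    · linarith
  -- With a the least point of s in [-M, 0], the translates of [0, M] by a, by 0 and by [0, N]
  -- already fill [a, M + N], since a + M ≥ 0.
  refine ⟨insert (a, M + N) (hfin.toFinset.image fun t => (t, t + M)),
    Finset.insert_nonempty _ _, ?_, ?_, ?_⟩
  · intro p hp
    rcases Finset.mem_insert.1 hp with rfl | hp
    · simp only; linarith
    · obtain ⟨t, -, rfl⟩ := Finset.mem_image.1 hp
      simp only; linarith
  · intro hM' p hp
    rcases Finset.mem_insert.1 hp with rfl | hp
    · simp only; linarith
    · obtain ⟨t, -, rfl⟩ := Finset.mem_image.1 hp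
      simp only; linarith
  · ext z
    simp only [Set.mem_add, Set.mem_iUnion, Finset.mem_insert, Finset.mem_image,
      Set.Finite.mem_toFinset, Set.mem_ofPred_eq, Set.mem_Icc, exists_prop]
    constructor
    · rintro ⟨r, ⟨hr0, hrM⟩, t, ht, rfl⟩
      rcases lt_or_ge t (-M) with h | h
      · exact ⟨(t, t + M), Or.inr ⟨t, ⟨ht, h⟩, rfl⟩, by simp only; linarith, by simp only; linarith⟩
      · exact ⟨(a, M + N), Or.inl rfl, by have := hmin' t ht h; simp only; linarith,
          by have := hup t ht; simp only; linarith⟩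
    · rintro ⟨p, rfl | ⟨t, ⟨ht, -⟩, rfl⟩, h1, h2⟩
      · simp only at h1 h2
        rcases le_or_gt z (a + M) with h | h
        · exact ⟨z - a, ⟨by linarith, by linarith⟩, a, has, by ring⟩
        · rcases le_or_gt z M with h' | h'
          · exact ⟨z, ⟨by linarith, h'⟩, 0, h0, by ring⟩
          · exact ⟨M, ⟨hM, le_rfl⟩, z - M, hsub ⟨by linarith, by linarith⟩, by ring⟩
      · exact ⟨z - t, ⟨by simp only at h1; linarith, by simp only at h2; linarith⟩, t, ht, by ring⟩

/-! ### Multiplication operators -/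

section MulOp

variable {X : Type*} [TopologicalSpace X] [CompactSpace X] [SecondCountableTopology X]
  [MeasureSpace X] [BorelSpace X]

theorem isSelfAdjoint_mulOp (w : C(X, ℝ)) : IsSelfAdjoint (mulOp w) := by
  rw [ContinuousLinearMap.isSelfAdjoint_iff_isSymmetric]
  intro f g
  rw [ContinuousLinearMap.coe_coe, L2.inner_def, L2.inner_def]
  refine integral_congr_ae ?_
  filter_upwards [mulOp_apply w f, mulOp_apply w g] with x hf hg
  rw [hf, hg, RCLike.inner_apply, RCLike.inner_apply, map_mul, Complex.conj_ofReal]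
  ring

theorem re_inner_mulOp_nonneg {w : C(X, ℝ)} (hw : ∀ x, 0 ≤ w x) (f : L2 X) :
    0 ≤ (inner ℂ f (mulOp w f)).re := by
  have e : inner ℂ f (mulOp w f) = ((∫ x, w x * ‖f x‖ ^ 2 : ℝ) : ℂ) := by
    rw [L2.inner_def, ← integral_complex_ofReal]
    refine integral_congr_ae ?_
    filter_upwards [mulOp_apply w f] with x hf
    rw [hf, RCLike.inner_apply, mul_assoc, Complex.mul_conj', Complex.ofReal_mul,
      Complex.ofReal_pow]
  rw [e, Complex.ofReal_re]
  exact integral_nonneg fun x => mul_nonneg (hw x) (sq_nonneg _)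

theorem re_inner_mulOp_le (w : C(X, ℝ)) (f : L2 X) :
    (inner ℂ f (mulOp w f)).re ≤ ‖w‖ * ‖f‖ ^ 2 := by
  have h1 := re_inner_le_norm (𝕜 := ℂ) f (mulOp w f)
  have h2 : ‖mulOp w f‖ ≤ ‖w‖ * ‖f‖ :=
    (mulOp w).le_of_opNorm_le (LinearMap.mkContinuous_norm_le _ (norm_nonneg _) _) f
  rw [RCLike.re_to_complex] at h1
  nlinarith [norm_nonneg f]

theorem mulOp_add (w w' : C(X, ℝ)) : mulOp (w + w') = mulOp w + mulOp w' := by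
  refine ContinuousLinearMap.ext fun f => Lp.ext ?_
  rw [add_apply]
  filter_upwards [mulOp_apply (w + w') f, mulOp_apply w f, mulOp_apply w' f,
    Lp.coeFn_add (mulOp w f) (mulOp w' f)] with x h1 h2 h3 h4
  rw [h1, h4, Pi.add_apply, h2, h3, ContinuousMap.add_apply, Complex.ofReal_add, add_mul]

end MulOp

/-! ### The Friedrichs model -/

theorem isOpenPosMeasure_unitInterval : (volume : Measure I).IsOpenPosMeasure where
  open_pos s hs hne := by
    obtain ⟨x, hx⟩ := hne
    obtain ⟨U, hU, rfl⟩ := isOpen_induced_iff.1 hs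
    have hcl : (x : ℝ) ∈ closure (Set.Ioo (0 : ℝ) 1) := by
      rw [closure_Ioo zero_ne_one]
      exact x.2
    have hpos := (hU.inter isOpen_Ioo).measure_pos volume (mem_closure_iff.1 hcl U hU hx)
    have hmeas : volume (Subtype.val ⁻¹' U : Set I) = volume (U ∩ Set.Icc (0 : ℝ) 1) := by
      rw [unitInterval.volume_apply, Subtype.image_preimage_coe, Set.inter_comm]
    rw [hmeas]
    exact (hpos.trans_le
      (measure_mono (Set.inter_subset_inter_right U Set.Ioo_subset_Icc_self))).ne'

/-- Compactness of K: the rows of k form a compact set in L². If f is orthogonal to a finite ε-net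
of the conjugated rows, then |(K f)(x)| ≤ ε‖f‖ for almost every x. -/
theorem exists_finiteDimensional_norm_K_le (k : C(I × I, ℂ)) {ε : ℝ} (hε : 0 < ε) :
    ∃ F : Submodule ℂ (L2 I), FiniteDimensional ℂ F ∧ ∀ f ∈ Fᗮ, ‖K k f‖ ≤ ε * ‖f‖ := by
  let κ : C(I, C(I, ℂ)) := ContinuousMap.curry ⟨fun p => starRingEnd ℂ (k p), by fun_prop⟩
  let R : I → L2 I := fun x => ContinuousMap.toLp 2 volume ℂ (κ x)
  have hR : Continuous R := (ContinuousMap.toLp 2 volume ℂ).continuous.comp κ.continuous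
  have hK : ∀ f, K k f =ᵐ[volume] fun x => inner ℂ (R x) f := by
    intro f
    filter_upwards [K_apply k f] with x hx
    rw [hx, L2.inner_def]
    refine integral_congr_ae ?_
    filter_upwards [ContinuousMap.coeFn_toLp (p := 2) (𝕜 := ℂ) (volume : Measure I) (κ x)] with s hs
    rw [show (R x : I → ℂ) s = κ x s from hs, RCLike.inner_apply]
    simp [κ, mul_comm]
  obtain ⟨t, ht, hcov⟩ := Metric.totallyBounded_iff.1 (isCompact_range hR).totallyBounded ε hε
  refine ⟨Submodule.span ℂ t, FiniteDimensional.span_of_finite ℂ ht, fun f hf => ?_⟩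
  have hb : ∀ᵐ x : I, ‖K k f x‖ ≤ ε * ‖f‖ := by
    filter_upwards [hK f] with x hx
    obtain ⟨g, hg, hxg⟩ := Set.mem_iUnion₂.1 (hcov ⟨x, rfl⟩)
    have h0 : inner ℂ g f = 0 := hf g (Submodule.subset_span hg)
    have h1 : inner ℂ (R x) f = inner ℂ (R x - g) f := by rw [inner_sub_left, h0, sub_zero]
    rw [hx, h1]
    refine (norm_inner_le_norm _ _).trans ?_
    gcongr
    rw [← dist_eq_norm]
    exact (Metric.mem_ball.1 hxg).le
  simpa [measureUnivNNReal] using Lp.norm_le_of_ae_bound (by positivity) hb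

/-- The functions in `L²(X)` that vanish outside of `s`. -/
def supportedOn {X : Type*} [MeasureSpace X] (s : Set X) : Submodule ℂ (L2 X) where
  carrier := {f | ∀ᵐ x, x ∉ s → f x = 0}
  add_mem' {f g} hf hg := by
    filter_upwards [hf, hg, Lp.coeFn_add f g] with x h1 h2 h3 hx
    rw [h3, Pi.add_apply, h1 hx, h2 hx, add_zero]
  zero_mem' := by
    filter_upwards [Lp.coeFn_zero ℂ 2 (volume : Measure X)] with x h _
    rw [h, Pi.zero_apply]
  smul_mem' c f hf := by
    filter_upwards [hf, Lp.coeFn_smul c f] with x h1 h2 hx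
    rw [h2, Pi.smul_apply, h1 hx, smul_zero]

/-- Multiplication by x would have an eigenvector on a nonzero finite-dimensional space, but an
eigenfunction can live only at a single point, a null set. -/
theorem not_finiteDimensional_supportedOn {s : Set I} (hs : IsOpen s) (hne : s.Nonempty) :
    ¬ FiniteDimensional ℂ (supportedOn s) := by
  intro hfin
  have := isOpenPosMeasure_unitInterval
  let m : C(I, ℝ) := ⟨fun x => x, by fun_prop⟩
  have hm : ∀ f ∈ supportedOn s, (mulOp m : L2 I →ₗ[ℂ] L2 I) f ∈ supportedOn s := by
    intro f hf
    filter_upwards [show ∀ᵐ x, x ∉ s → f x = 0 from hf, mulOp_apply m f] with x h1 h2 hx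
    rw [ContinuousLinearMap.coe_coe, h2, h1 hx, mul_zero]
  have hnt : Nontrivial (supportedOn s) := by
    have hfm : volume s ≠ ∞ := measure_ne_top _ _
    refine ⟨⟨indicatorConstLp 2 hs.measurableSet hfm (1 : ℂ), ?_⟩, 0, fun h => ?_⟩
    · filter_upwards [indicatorConstLp_coeFn (p := 2) (hs := hs.measurableSet) (hμs := hfm)
        (c := (1 : ℂ))] with x h1 hx
      rw [h1, Set.indicator_of_notMem hx]
    · have h1 := congrArg (fun g : supportedOn s => ‖(g : L2 I)‖) h
      simp only [Submodule.coe_zero, norm_zero] at h1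
      rw [norm_indicatorConstLp (by norm_num) (by norm_num), norm_one, one_mul] at h1
      have h2 : 0 < (volume : Measure I).real s :=
        ENNReal.toReal_pos (hs.measure_pos volume hne).ne' hfm
      exact (Real.rpow_pos_of_pos h2 _).ne' h1
  obtain ⟨c, hc⟩ := Module.End.exists_eigenvalue ((mulOp m : L2 I →ₗ[ℂ] L2 I).restrict hm)
  obtain ⟨f, hf⟩ := hc.exists_hasEigenvector
  have hfe : mulOp m f = c • (f : L2 I) := congrArg Subtype.val hf.apply_eq_smul
  refine hf.2 (Subtype.ext ((Lp.eq_zero_iff_ae_eq_zero).2 ?_))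
  have hnull : ∀ᵐ x : I, ((x : ℝ) : ℂ) ≠ c := by
    have hsub : {x : I | ¬ ((x : ℝ) : ℂ) ≠ c}.Subsingleton := by
      intro x hx y hy
      simp only [ne_eq, not_not, Set.mem_ofPred_eq] at hx hy
      exact Subtype.ext (Complex.ofReal_injective (hx.trans hy.symm))
    exact hsub.measure_zero volume
  have h1 := mulOp_apply m f
  rw [hfe] at h1
  filter_upwards [hnull, h1, Lp.coeFn_smul c (f : L2 I)] with x hx h1 h2
  rw [h2, Pi.smul_apply, smul_eq_mul] at h1
  have h3 : (((x : ℝ) : ℂ) - c) * (f : L2 I) x = 0 := by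
    rw [sub_mul, sub_eq_zero]
    exact h1.symm
  exact (mul_eq_zero.1 h3).resolve_left (sub_ne_zero.2 hx)

section H

variable {u : C(I, ℝ)} {k : C(I × I, ℂ)}

theorem isSelfAdjoint_H (hK : (K k).IsPositive) : IsSelfAdjoint (H u k) :=
  (isSelfAdjoint_mulOp u).sub hK.isSelfAdjoint

theorem re_inner_H_le (hK : (K k).IsPositive) (f : L2 I) :
    (inner ℂ f (H u k f)).re ≤ ‖u‖ * ‖f‖ ^ 2 := by
  have h1 := hK.re_inner_nonneg_right f
  have h2 := re_inner_mulOp_le u f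
  rw [RCLike.re_to_complex] at h1
  rw [H, sub_apply, inner_sub_right, Complex.sub_re]
  linarith

theorem essentiallyNonneg_H (hu : ∀ x, 0 ≤ u x) : EssentiallyNonneg (H u k) := by
  intro δ hδ
  obtain ⟨F, hF, hFK⟩ := exists_finiteDimensional_norm_K_le k hδ
  refine ⟨F, hF, fun f hf => ?_⟩
  have h1 := re_inner_le_norm (𝕜 := ℂ) f (K k f)
  have h2 := re_inner_mulOp_nonneg hu f
  have h3 := hFK f hf
  rw [RCLike.re_to_complex] at h1
  rw [H, sub_apply, inner_sub_right, Complex.sub_re]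
  nlinarith [norm_nonneg f]

/-- Functions supported where u is close to u(x₀) make U - u(x₀) small, and orthogonality to F makes
K small. -/
theorem hasSingularSubspaces_H (x₀ : I) : HasSingularSubspaces (H u k) (u x₀ : ℝ) := by
  intro ε hε
  obtain ⟨F, hF, hFK⟩ := exists_finiteDimensional_norm_K_le k (half_pos hε)
  set s : Set I := {x | |u x - u x₀| < ε / 2}
  have hs : IsOpen s := isOpen_lt (by fun_prop) continuous_const
  have hx₀ : x₀ ∈ s := by simp [s, hε]
  refine ⟨supportedOn s ⊓ Fᗮ, fun hfin => ?_, ?_⟩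
  -- Were the intersection finite-dimensional, some f ≠ 0 supported on s would be orthogonal to it
  -- and to F, hence belong to it and be orthogonal to itself.
  · obtain ⟨f, hfs, hf, h0⟩ := exists_mem_orthogonal_of_not_finiteDimensional
      (N := F ⊔ (supportedOn s ⊓ Fᗮ)) (not_finiteDimensional_supportedOn hs ⟨x₀, hx₀⟩)
    have hfF : f ∈ Fᗮ := Submodule.orthogonal_le le_sup_left hf
    exact h0 (inner_self_eq_zero (𝕜 := ℂ).1 (hf f (le_sup_right (a := F)
      (b := supportedOn s ⊓ Fᗮ) ⟨hfs, hfF⟩)))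
  · rintro f ⟨hfs, hfF⟩
    have h1 : ‖mulOp u f - ((u x₀ : ℝ) : ℂ) • f‖ ≤ ε / 2 * ‖f‖ := by
      refine Lp.norm_le_mul_norm_of_ae_le_mul ?_
      filter_upwards [mulOp_apply u f, Lp.coeFn_sub (mulOp u f) (((u x₀ : ℝ) : ℂ) • f),
        Lp.coeFn_smul ((u x₀ : ℝ) : ℂ) f, show ∀ᵐ x, x ∉ s → f x = 0 from hfs]
        with x e1 e2 e3 e4
      rw [e2, Pi.sub_apply, e1, e3, Pi.smul_apply, smul_eq_mul, ← sub_mul, ← Complex.ofReal_sub,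
        norm_mul, Complex.norm_real, Real.norm_eq_abs]
      by_cases hx : x ∈ s
      · exact mul_le_mul_of_nonneg_right (le_of_lt hx) (norm_nonneg _)
      · rw [e4 hx]; simp
    have e : H u k f - ((u x₀ : ℝ) : ℂ) • f = (mulOp u f - ((u x₀ : ℝ) : ℂ) • f) - K k f := by
      rw [H, sub_apply]; abel
    rw [e]
    have h2 := hFK f hfF
    have h3 := norm_sub_le (mulOp u f - ((u x₀ : ℝ) : ℂ) • f) (K k f)
    linarith

theorem exists_apply_eq (hu : ∀ x, 0 ≤ u x) (hu0 : ∃ x, u x = 0) {t : ℝ}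
    (ht : t ∈ Set.Icc 0 ‖u‖) : ∃ x, u x = t := by
  obtain ⟨x₀, hx₀⟩ := hu0
  obtain ⟨x₁, -, hx₁⟩ := isCompact_univ.exists_isMaxOn (f := u) ⟨x₀, trivial⟩
    u.continuous.continuousOn
  have hmax : ‖u‖ ≤ u x₁ := (u.norm_le (hu x₁)).2 fun x => by
    rw [Real.norm_of_nonneg (hu x)]
    exact hx₁ (Set.mem_univ x)
  exact mem_range_of_exists_le_of_exists_ge u.continuous ⟨x₀, hx₀ ▸ ht.1⟩ ⟨x₁, ht.2.trans hmax⟩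

theorem hasSingularSubspaces_H_of_mem_Icc (hu : ∀ x, 0 ≤ u x) (hu0 : ∃ x, u x = 0) {t : ℝ}
    (ht : t ∈ Set.Icc 0 ‖u‖) : HasSingularSubspaces (H u k) t := by
  obtain ⟨x, rfl⟩ := exists_apply_eq hu hu0 ht
  exact hasSingularSubspaces_H x

end H

/-! ### `L²([0,1]²)` as a tensor product -/

theorem measurePreserving_fst' : MeasurePreserving (fun p : I × I => p.1) :=
  measurePreserving_fst (μ := (volume : Measure I)) (ν := (volume : Measure I))

theorem memLp_tensor (φ ψ : L2 I) :
    MemLp (fun p : I × I => φ p.1 * ψ p.2) 2 (volume : Measure (I × I)) := by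
  have hφ := (Lp.aestronglyMeasurable φ).comp_measurePreserving measurePreserving_fst'
  have hψ := (Lp.aestronglyMeasurable ψ).comp_measurePreserving measurePreserving_snd'
  refine (memLp_two_iff_integrable_sq_norm (hφ.mul hψ)).2 ?_
  have h := ((memLp_two_iff_integrable_sq_norm (Lp.aestronglyMeasurable φ)).1 (Lp.memLp φ)).mul_prod
    ((memLp_two_iff_integrable_sq_norm (Lp.aestronglyMeasurable ψ)).1 (Lp.memLp ψ))
  refine h.congr (.of_forall fun p => ?_)
  simp [mul_pow]

/-- `(φ ⊗ ψ)(x, y) = φ(x) ψ(y)`. -/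
def tensor : L2 I →ₗ[ℂ] L2 I →ₗ[ℂ] L2 (I × I) :=
  LinearMap.mk₂ ℂ (fun φ ψ => (memLp_tensor φ ψ).toLp)
    (fun φ φ' ψ => by
      rw [← MemLp.toLp_add]
      refine MemLp.toLp_congr _ _ ?_
      filter_upwards [measurePreserving_fst'.quasiMeasurePreserving.ae (Lp.coeFn_add φ φ')]
        with p hp
      rw [hp, Pi.add_apply, Pi.add_apply, add_mul])
    (fun c φ ψ => by
      rw [← MemLp.toLp_const_smul]
      refine MemLp.toLp_congr _ _ ?_
      filter_upwards [measurePreserving_fst'.quasiMeasurePreserving.ae (Lp.coeFn_smul c φ)]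
        with p hp
      rw [hp, Pi.smul_apply, Pi.smul_apply, smul_mul_assoc])
    (fun φ ψ ψ' => by
      rw [← MemLp.toLp_add]
      refine MemLp.toLp_congr _ _ ?_
      filter_upwards [measurePreserving_snd'.quasiMeasurePreserving.ae (Lp.coeFn_add ψ ψ')]
        with p hp
      rw [hp, Pi.add_apply, Pi.add_apply, mul_add])
    (fun c φ ψ => by
      rw [← MemLp.toLp_const_smul]
      refine MemLp.toLp_congr _ _ ?_
      filter_upwards [measurePreserving_snd'.quasiMeasurePreserving.ae (Lp.coeFn_smul c ψ)]
        with p hp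
      rw [hp, Pi.smul_apply, Pi.smul_apply, mul_smul_comm])

theorem tensor_apply (φ ψ : L2 I) : tensor φ ψ =ᵐ[volume] fun p => φ p.1 * ψ p.2 :=
  (memLp_tensor φ ψ).coeFn_toLp

theorem inner_tensor (φ ψ φ' ψ' : L2 I) :
    inner ℂ (tensor φ ψ) (tensor φ' ψ') = inner ℂ φ φ' * inner ℂ ψ ψ' := by
  rw [L2.inner_def, L2.inner_def, L2.inner_def]
  refine Eq.trans (integral_congr_ae ?_)
    (integral_prod_mul (μ := (volume : Measure I)) (ν := (volume : Measure I))
      (fun x => inner ℂ (φ x) (φ' x)) fun y => inner ℂ (ψ y) (ψ' y))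
  filter_upwards [tensor_apply φ ψ, tensor_apply φ' ψ'] with p h h'
  rw [h, h']
  simp only [RCLike.inner_apply, map_mul]
  ring

theorem tensor_indicator {s t : Set I} (hs : MeasurableSet s) (ht : MeasurableSet t) :
    tensor (indicatorConstLp 2 hs (measure_ne_top _ _) 1)
        (indicatorConstLp 2 ht (measure_ne_top _ _) 1)
      = indicatorConstLp 2 (hs.prod ht) (measure_ne_top _ _) (1 : ℂ) := by
  refine Lp.ext ?_
  filter_upwards [tensor_apply (indicatorConstLp 2 hs (measure_ne_top _ _) 1)
      (indicatorConstLp 2 ht (measure_ne_top _ _) 1),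
    measurePreserving_fst'.quasiMeasurePreserving.ae
      (indicatorConstLp_coeFn (p := 2) (hs := hs) (hμs := measure_ne_top _ _) (c := (1 : ℂ))),
    measurePreserving_snd'.quasiMeasurePreserving.ae
      (indicatorConstLp_coeFn (p := 2) (hs := ht) (hμs := measure_ne_top _ _) (c := (1 : ℂ))),
    indicatorConstLp_coeFn (p := 2) (hs := hs.prod ht) (hμs := measure_ne_top volume _)
      (c := (1 : ℂ))] with p h1 h2 h3 h4
  rw [h1, h2, h3, h4]
  by_cases hp : p.1 ∈ s <;> by_cases hq : p.2 ∈ t <;> simp [Set.indicator, Set.mem_prod, hp, hq]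

/-- For totality, testing against products of indicators kills the integrals of g over rectangles;
these form a π-system generating the σ-algebra, so all set integrals vanish. -/
theorem isHilbertTensor_tensor : IsHilbertTensor tensor where
  inner_eq := inner_tensor
  eq_zero g hg := by
    have hint : Integrable g (volume : Measure (I × I)) := (Lp.memLp g).integrable one_le_two
    have hrect : ∀ s t : Set I, MeasurableSet s → MeasurableSet t → ∫ p in s ×ˢ t, g p = 0 := by
      intro s t hs ht
      have h := hg (indicatorConstLp 2 hs (measure_ne_top _ _) 1)
        (indicatorConstLp 2 ht (measure_ne_top _ _) 1)
      rwa [tensor_indicator hs ht, L2.inner_indicatorConstLp_one] at h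
    have hall : ∀ s : Set (I × I), MeasurableSet s → ∫ p in s, g p = 0 := by
      have huniv : ∫ p, g p = 0 := by
        have := hrect _ _ MeasurableSet.univ MeasurableSet.univ
        rwa [Set.univ_prod_univ, setIntegral_univ] at this
      intro s hs
      induction s, hs using MeasurableSpace.induction_on_inter generateFrom_prod.symm
        isPiSystem_prod with
      | empty => simp
      | basic r hr =>
        obtain ⟨s, hs, t, ht, rfl⟩ := hr
        exact hrect s t hs ht
      | compl r hr ih =>
        have := integral_add_compl hr hint
        rwa [ih, huniv, zero_add] at this
      | iUnion f hd hm ih =>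
        rw [integral_iUnion hm hd hint.integrableOn]
        simp [ih]
    exact (Lp.eq_zero_iff_ae_eq_zero).2
      (hint.ae_eq_zero_of_forall_setIntegral_eq_zero fun s hs _ => hall s hs)

theorem T₁_tensor (k : C(I × I, ℂ)) (φ ψ : L2 I) : T₁ k (tensor φ ψ) = tensor (K k φ) ψ := by
  refine Lp.ext ?_
  filter_upwards [integralOp_apply (⟨fun q => k (q.1.1, q.2), by fun_prop⟩ : C((I × I) × I, ℂ))
      measurePreserving_replace_fst (tensor φ ψ), tensor_apply (K k φ) ψ,
    measurePreserving_fst'.quasiMeasurePreserving.ae (K_apply k φ),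
    Measure.ae_ae_of_ae_prod
      (measurePreserving_replace_fst.quasiMeasurePreserving.ae (tensor_apply φ ψ))]
    with p h1 h2 h3 h4
  rw [T₁, h1, h2, h3, ← integral_mul_const]
  refine integral_congr_ae ?_
  filter_upwards [h4] with s hs
  rw [hs, ContinuousMap.coe_mk, mul_assoc]

theorem T₂_tensor (k : C(I × I, ℂ)) (φ ψ : L2 I) : T₂ k (tensor φ ψ) = tensor φ (K k ψ) := by
  refine Lp.ext ?_
  filter_upwards [integralOp_apply (⟨fun q => k (q.1.2, q.2), by fun_prop⟩ : C((I × I) × I, ℂ))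
      measurePreserving_replace_snd (tensor φ ψ), tensor_apply φ (K k ψ),
    measurePreserving_snd'.quasiMeasurePreserving.ae (K_apply k ψ),
    Measure.ae_ae_of_ae_prod
      (measurePreserving_replace_snd.quasiMeasurePreserving.ae (tensor_apply φ ψ))]
    with p h1 h2 h3 h4
  rw [T₂, h1, h2, h3, ← integral_const_mul]
  refine integral_congr_ae ?_
  filter_upwards [h4] with s hs
  rw [hs, ContinuousMap.coe_mk]
  ring

theorem mulOp_fst_tensor (u : C(I, ℝ)) (φ ψ : L2 I) :
    mulOp (⟨fun p => u p.1, by fun_prop⟩ : C(I × I, ℝ)) (tensor φ ψ) = tensor (mulOp u φ) ψ := by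
  refine Lp.ext ?_
  filter_upwards [mulOp_apply (⟨fun p => u p.1, by fun_prop⟩ : C(I × I, ℝ)) (tensor φ ψ),
    tensor_apply φ ψ, tensor_apply (mulOp u φ) ψ,
    measurePreserving_fst'.quasiMeasurePreserving.ae (mulOp_apply u φ)] with p h1 h2 h3 h4
  rw [h1, h2, h3, h4, ContinuousMap.coe_mk, mul_assoc]

theorem mulOp_snd_tensor (v : C(I, ℝ)) (φ ψ : L2 I) :
    mulOp (⟨fun p => v p.2, by fun_prop⟩ : C(I × I, ℝ)) (tensor φ ψ) = tensor φ (mulOp v ψ) := by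
  refine Lp.ext ?_
  filter_upwards [mulOp_apply (⟨fun p => v p.2, by fun_prop⟩ : C(I × I, ℝ)) (tensor φ ψ),
    tensor_apply φ ψ, tensor_apply φ (mulOp v ψ),
    measurePreserving_snd'.quasiMeasurePreserving.ae (mulOp_apply v ψ)] with p h1 h2 h3 h4
  rw [h1, h2, h3, h4, ContinuousMap.coe_mk]
  ring

/-- `H ⊗ 1`. -/
def liftFst (u : C(I, ℝ)) (k : C(I × I, ℂ)) : L2 (I × I) →L[ℂ] L2 (I × I) :=
  mulOp ⟨fun p => u p.1, by fun_prop⟩ - T₁ k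

/-- `1 ⊗ H`. -/
def liftSnd (v : C(I, ℝ)) (k : C(I × I, ℂ)) : L2 (I × I) →L[ℂ] L2 (I × I) :=
  mulOp ⟨fun p => v p.2, by fun_prop⟩ - T₂ k

theorem liftFst_tensor (u : C(I, ℝ)) (k : C(I × I, ℂ)) (φ ψ : L2 I) :
    liftFst u k (tensor φ ψ) = tensor (H u k φ) ψ := by
  rw [liftFst, sub_apply, mulOp_fst_tensor, T₁_tensor, H, sub_apply, map_sub,
    LinearMap.sub_apply]

theorem liftSnd_tensor (v : C(I, ℝ)) (k : C(I × I, ℂ)) (φ ψ : L2 I) :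
    liftSnd v k (tensor φ ψ) = tensor φ (H v k ψ) := by
  rw [liftSnd, sub_apply, mulOp_snd_tensor, T₂_tensor, H, sub_apply, map_sub]

/-! ### The essential spectrum of T -/

theorem T_eq_add (u v : C(I, ℝ)) (k₁ k₂ : C(I × I, ℂ)) :
    T u v k₁ k₂ = liftFst u k₁ + liftSnd v k₂ := by
  have h : T₀ u v = mulOp (⟨fun p => u p.1, by fun_prop⟩ : C(I × I, ℝ))
      + mulOp (⟨fun p => v p.2, by fun_prop⟩ : C(I × I, ℝ)) := by
    rw [← mulOp_add]
    rfl
  rw [T, liftFst, liftSnd, h]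
  abel

open scoped Pointwise in
theorem essentialSpectrum_T {u v : C(I, ℝ)} (hu : ∀ x, 0 ≤ u x) (hv : ∀ y, 0 ≤ v y)
    (hu0 : ∃ x, u x = 0) (hv0 : ∃ y, v y = 0) {k₁ k₂ : C(I × I, ℂ)}
    (hK₁ : (K k₁).IsPositive) (hK₂ : (K k₂).IsPositive) :
    essentialSpectrum (T u v k₁ k₂) = Complex.ofReal ''
      ((Set.Icc 0 ‖u‖ + {t : ℝ | (t : ℂ) ∈ spectrum ℂ (H v k₂)})
        ∪ (Set.Icc 0 ‖v‖ + {t : ℝ | (t : ℂ) ∈ spectrum ℂ (H u k₁)})) := by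
  have hS₁ : IsSelfAdjoint (H u k₁) := isSelfAdjoint_H hK₁
  have hS₂ : IsSelfAdjoint (H v k₂) := isSelfAdjoint_H hK₂
  have ht := isHilbertTensor_tensor
  have hA := liftFst_tensor u k₁
  have hB := liftSnd_tensor v k₂
  have hT : IsSelfAdjoint (liftFst u k₁ + liftSnd v k₂) :=
    (ht.isSelfAdjoint_lift hS₁ hA).add (ht.flip.isSelfAdjoint_lift hS₂ fun b a => hB a b)
  rw [T_eq_add]
  refine Set.Subset.antisymm ?_ ?_
  · rintro w ⟨hw, hwd⟩
    obtain ⟨z, rfl⟩ := exists_real_of_mem_spectrum hT hw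
    refine ⟨z, ?_, rfl⟩
    by_contra hz
    rw [Set.mem_union, not_or] at hz
    exact hwd (ht.mem_discreteSpectrum hS₁ hS₂ hA hB (essentiallyNonneg_H hu)
      (essentiallyNonneg_H hv) (norm_nonneg u) (norm_nonneg v) (re_inner_H_le hK₁)
      (re_inner_H_le hK₂) (fun s hs t ht h => hz.1 ⟨s, hs, t, ht, h.symm⟩)
      (fun s hs t ht h => hz.2 ⟨s, hs, t, ht, h.symm⟩) hw)
  · rintro _ ⟨z, ⟨s, hs, t, hts, rfl⟩ | ⟨s, hs, t, hts, rfl⟩, rfl⟩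
    · exact (ht.hasSingularSubspaces_add hS₂ hA hB
        (hasSingularSubspaces_H_of_mem_Icc hu hu0 hs) hts).mem_essentialSpectrum hT
    · rw [add_comm] at hT ⊢
      exact (ht.flip.hasSingularSubspaces_add hS₁ (fun b a => hB a b) (fun b a => hA a b)
        (hasSingularSubspaces_H_of_mem_Icc hv hv0 hs) hts).mem_essentialSpectrum hT

open scoped Pointwise in
theorem exists_finset_Icc_add_spectrum_H {u : C(I, ℝ)} (hu : ∀ x, 0 ≤ u x)
    (hu0 : ∃ x, u x = 0) {k : C(I × I, ℂ)} (hK : (K k).IsPositive) (v : C(I, ℝ))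
    (h : v ≠ 0 ∨ (discreteSpectrum (H u k)).Finite) :
    ∃ P : Finset (ℝ × ℝ), P.Nonempty ∧ (∀ p ∈ P, p.1 ≤ p.2) ∧ (v ≠ 0 → ∀ p ∈ P, p.1 < p.2) ∧
      Set.Icc 0 ‖v‖ + {t : ℝ | (t : ℂ) ∈ spectrum ℂ (H u k)} = ⋃ p ∈ P, Set.Icc p.1 p.2 := by
  have hS : IsSelfAdjoint (H u k) := isSelfAdjoint_H hK
  rw [← norm_pos_iff] at h ⊢
  refine exists_finset_Icc_add (norm_nonneg v) (norm_nonneg u)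
    ((spectrum.isClosed (H u k)).preimage Complex.continuous_ofReal)
    (fun t ht => le_of_mem_spectrum hS (re_inner_H_le hK) ht)
    (fun t ht => ((hasSingularSubspaces_H_of_mem_Icc hu hu0 ht).mem_essentialSpectrum hS).1) ?_
  -- If v ≠ 0, only spectrum below -‖v‖ < 0 counts, and it is always finite. Otherwise the negative
  -- spectrum is finite because it is part of the discrete spectrum.
  rcases h with h | h
  · exact (essentiallyNonneg_H hu).finite_spectrum_lt hS h
  · refine Set.Finite.of_finite_image (f := Complex.ofReal) (h.subset ?_)
      Complex.ofReal_injective.injOn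
    rintro _ ⟨t, ⟨ht, htv⟩, rfl⟩
    exact (essentiallyNonneg_H hu).mem_discreteSpectrum hS
      (htv.trans_le (neg_nonpos.2 (norm_nonneg v))) ht

end FriedrichsModel

end

theorem mainTheorem9
    (u v : C(unitInterval, ℝ))
    (hu_nonneg : ∀ x, 0 ≤ u x) (hv_nonneg : ∀ y, 0 ≤ v y)
    (hu_zero : ∃ x, u x = 0) (hv_zero : ∃ y, v y = 0)
    (k₁ k₂ : C(unitInterval × unitInterval, ℂ))
    (hk₁ : ∀ x s, k₁ (x, s) = starRingEnd ℂ (k₁ (s, x)))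
    (hk₂ : ∀ x s, k₂ (x, s) = starRingEnd ℂ (k₂ (s, x)))
    (hK₁ : (FriedrichsModel.K k₁).IsPositive) (hK₂ : (FriedrichsModel.K k₂).IsPositive)
    (hv : v ≠ 0 ∨ (FriedrichsModel.discreteSpectrum (FriedrichsModel.H u k₁)).Finite)
    (hu : u ≠ 0 ∨ (FriedrichsModel.discreteSpectrum (FriedrichsModel.H v k₂)).Finite) :
    ∃ (n : ℕ) (a b : Fin n → ℝ), 0 < n ∧ (∀ i, a i ≤ b i) ∧
      (u ≠ 0 → v ≠ 0 → ∀ i, a i < b i) ∧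
      FriedrichsModel.essentialSpectrum (FriedrichsModel.T u v k₁ k₂) =
        ⋃ i, Complex.ofReal '' Set.Icc (a i) (b i) := by
  classical
  obtain ⟨P, hP, hPle, hPlt, hPeq⟩ :=
    FriedrichsModel.exists_finset_Icc_add_spectrum_H hv_nonneg hv_zero hK₂ u hu
  obtain ⟨Q, -, hQle, hQlt, hQeq⟩ :=
    FriedrichsModel.exists_finset_Icc_add_spectrum_H hu_nonneg hu_zero hK₁ v hv
  -- P covers [0,‖u‖] + σ(H₂) and Q covers [0,‖v‖] + σ(H₁); their union is enumerated by `Fin n`.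
  let e := (P ∪ Q).equivFin.symm
  have hmem : ∀ i, (e i : ℝ × ℝ) ∈ P ∨ (e i : ℝ × ℝ) ∈ Q := fun i =>
    Finset.mem_union.1 (e i).2
  refine ⟨(P ∪ Q).card, fun i => (e i : ℝ × ℝ).1, fun i => (e i : ℝ × ℝ).2,
    Finset.card_pos.2 (hP.mono Finset.subset_union_left),
    fun i => (hmem i).elim (hPle _) (hQle _),
    fun hu' hv' i => (hmem i).elim (hPlt hu' _) (hQlt hv' _), ?_⟩
  rw [FriedrichsModel.essentialSpectrum_T hu_nonneg hv_nonneg hu_zero hv_zero hK₁ hK₂, hPeq, hQeq,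
    ← Set.image_iUnion, ← Finset.set_biUnion_union]
  congr 1
  ext z
  simp only [Set.mem_iUnion, exists_prop]
  exact ⟨fun ⟨p, hp, hz⟩ => ⟨e.symm ⟨p, hp⟩, by
      rw [Equiv.apply_symm_apply]
      exact hz⟩,
    fun ⟨i, hi⟩ => ⟨e i, (e i).2, hi⟩⟩
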